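/- A uniform algebra on a non-empty compact Hausdorff space $X$ is a subalgebra $A$ of $C(X)=C(X,\mathbb{C})$ that is closed in the supremum norm, contains the constant functions and separates the points of $X$. The essential set of $A$ is the smallest closed subset $E$ of $X$ such that $A$ contains every continuous function on $X$ that vanishes on $E$; $A$ is essential if $E=X$. $A$ is natural (on $X$) if the only non-zero multiplicative linear functionals on $A$ are the evaluations at the points of $X$. $A$ is regular on $X$ if for each closed subset $E\subseteq X$ and each $x\in X\setminus E$ there is $f\in A$ with $f(x)=1$ and $f(E)\subseteq\{0\}$; $A$ is regular if it is natural and regular on $X$. **Theorem 1.2.** There exists an essential, natural, regular uniform algebra on the closed unit disc $\overline{\mathbb{D}}=\{z\in\mathbb{C}:|z|\le 1\}$. -/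

import Mathlib

/-- `A` is a uniform algebra on the compact space `X`: a subalgebra of `C(X)` (hence containing the
constant functions), closed in the supremum norm and separating the points of `X`. The topology of
`C(X, ℂ)` is that of uniform convergence because `X` is compact. -/
structure IsUniformAlgebra {X : Type*} [TopologicalSpace X] [CompactSpace X] [T2Space X]
    (A : Subalgebra ℂ C(X, ℂ)) : Prop where
  isClosed : IsClosed (A : Set C(X, ℂ))
  separatesPoints : ∀ x y : X, x ≠ y → ∃ f ∈ A, f x ≠ f y

/-- `E` is the essential set of `A`: the smallest closed subset of `X` such that `A` contains every
continuous function that vanishes on it. -/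
def IsEssentialSet {X : Type*} [TopologicalSpace X]
    (A : Subalgebra ℂ C(X, ℂ)) (E : Set X) : Prop :=
  IsLeast {F : Set X | IsClosed F ∧ ∀ f : C(X, ℂ), (∀ x ∈ F, f x = 0) → f ∈ A} E

/-- `A` is essential: its essential set is all of `X`. -/
def IsEssentialAlgebra {X : Type*} [TopologicalSpace X] (A : Subalgebra ℂ C(X, ℂ)) : Prop :=
  IsEssentialSet A Set.univ

/-- `A` is natural on `X`: the only non-zero multiplicative linear functionals on `A` are the
evaluations at the points of `X`. -/
def IsNaturalAlgebra {X : Type*} [TopologicalSpace X] (A : Subalgebra ℂ C(X, ℂ)) : Prop :=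
  ∀ φ : A →ₗ[ℂ] ℂ, φ ≠ 0 → (∀ f g : A, φ (f * g) = φ f * φ g) →
    ∃ x : X, ∀ f : A, φ f = (f : C(X, ℂ)) x

/-- `A` is regular on `X`: it separates the points of `X` from the closed subsets of `X`. -/
def IsRegularOnSpace {X : Type*} [TopologicalSpace X] (A : Subalgebra ℂ C(X, ℂ)) : Prop :=
  ∀ E : Set X, IsClosed E → ∀ x : X, x ∉ E → ∃ f ∈ A, f x = 1 ∧ ∀ y ∈ E, f y = 0

/-- `A` is regular: it is natural and regular on `X`. -/
def IsRegularAlgebra {X : Type*} [TopologicalSpace X] (A : Subalgebra ℂ C(X, ℂ)) : Prop :=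
  IsNaturalAlgebra A ∧ IsRegularOnSpace A

/-! The algebra is glued from McKissick's Swiss cheeses. Pairwise disjoint Swiss cheeses `K n` are
placed in the open disc, with diameters tending to 0 and at least one inside every non-empty open
subset of the disc. `A` consists of the continuous functions whose restriction to each `K n` lies in
the uniform closure `A n` of the functions holomorphic near `K n`.

Each `A n` is natural, regular and proper, and `A` inherits what is needed. Essentiality: if `A`
contained every function vanishing on a proper closed set `F`, Tietze's theorem on some `K n`
missing `F` would give `A n = C(K n)`. For regularity and naturality, the diameter condition makes
the quotient of the disc collapsing any selection of the `K n` to points compact Hausdorff. Tietze's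
theorem there extends an element of `A n` by a function constant on every other `K m`, hence in `A`
(`exists_mem_gluedAlgebra`). When all `K n` are collapsed, a character of `A` restricts to a point
evaluation on the functions on the quotient, so it depends only on the values on one fibre: a point,
or some `K n`, where naturality of `A n` applies.

Two estimates produce the cheeses. Discs of arbitrarily small total radius can be removed so that
off them some uniform limit of rational functions is non-zero in a given disc and zero outside it
(`exists_cheeseFamily`); doing this for a countable base of discs gives regularity. If the total
radius is small enough, a Green's formula argument shows that complex conjugation is not a limit of
functions holomorphic near the remaining set (`not_isHolomorphicLimit_conj`), so the algebra is
proper. -/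

open Filter Topology MeasureTheory

/-! ### Characters, and naturality of algebras of holomorphic functions. -/

section Characters

variable {X : Type*} [TopologicalSpace X] {A : Subalgebra ℂ C(X, ℂ)}

/-- A non-zero multiplicative linear functional, as a unital algebra homomorphism. -/
noncomputable def characterAlgHom (φ : A →ₗ[ℂ] ℂ) (h0 : φ ≠ 0)
    (hmul : ∀ f g : A, φ (f * g) = φ f * φ g) : A →ₐ[ℂ] ℂ :=
  AlgHom.ofLinearMap φ
    (by
      obtain ⟨f, hf⟩ : ∃ f, φ f ≠ 0 := by
        by_contra! h
        exact h0 (LinearMap.ext h)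
      have h1 := hmul 1 f
      rw [one_mul] at h1
      exact mul_right_cancel₀ hf (by rw [one_mul]; exact h1.symm))
    hmul

theorem norm_character_le [CompactSpace X] (hA : IsClosed (A : Set C(X, ℂ))) (φ : A →ₐ[ℂ] ℂ)
    (f : A) : ‖φ f‖ ≤ ‖f‖ := by
  have : CompleteSpace A := hA.completeSpace_coe
  refine (AlgHom.norm_apply_le_self_mul_norm_one φ f).trans ?_
  refine mul_le_of_le_one_right (norm_nonneg _) ?_
  -- Only an inequality is available: the norm of `1` is 0 when `X` is empty.
  change ‖(1 : C(X, ℂ))‖ ≤ 1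
  rw [ContinuousMap.norm_le _ zero_le_one]
  simp

end Characters

theorem algHom_sub_mul_add {B : Type*} [Ring B] [Algebra ℂ B] (φ : B →ₐ[ℂ] ℂ) (a b : B)
    (c d : ℂ) : φ ((a - algebraMap ℂ B c) * b + algebraMap ℂ B d) = (φ a - c) * φ b + d := by
  simp

section HolomorphicTrace

variable {Y : Type*} [TopologicalSpace Y] [CompactSpace Y]

/-- The functions on `Y` which factor through `j` and a function holomorphic near the range
of `j`. -/
def holomorphicTrace (j : C(Y, ℂ)) : Subalgebra ℂ C(Y, ℂ) where
  carrier := {f | ∃ U : Set ℂ, IsOpen U ∧ (∀ y, j y ∈ U) ∧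
    ∃ g : ℂ → ℂ, DifferentiableOn ℂ g U ∧ ∀ y, f y = g (j y)}
  mul_mem' := by
    rintro f₁ f₂ ⟨U, hU, hjU, g, hg, hfg⟩ ⟨V, hV, hjV, k, hk, hfk⟩
    exact ⟨U ∩ V, hU.inter hV, fun y => ⟨hjU y, hjV y⟩, fun z => g z * k z,
      (hg.mono Set.inter_subset_left).mul (hk.mono Set.inter_subset_right),
      fun y => by simp [hfg, hfk]⟩
  add_mem' := by
    rintro f₁ f₂ ⟨U, hU, hjU, g, hg, hfg⟩ ⟨V, hV, hjV, k, hk, hfk⟩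
    exact ⟨U ∩ V, hU.inter hV, fun y => ⟨hjU y, hjV y⟩, fun z => g z + k z,
      (hg.mono Set.inter_subset_left).add (hk.mono Set.inter_subset_right),
      fun y => by simp [hfg, hfk]⟩
  algebraMap_mem' c :=
    ⟨Set.univ, isOpen_univ, fun _ => trivial, fun _ => c, differentiableOn_const c, fun _ => rfl⟩

/-- The uniform closure of the functions holomorphic near the range of `j`. -/
noncomputable def uniformHolomorphic (j : C(Y, ℂ)) : Subalgebra ℂ C(Y, ℂ) :=
  (holomorphicTrace j).topologicalClosure

theorem isClosed_uniformHolomorphic (j : C(Y, ℂ)) :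
    IsClosed (uniformHolomorphic j : Set C(Y, ℂ)) :=
  Subalgebra.isClosed_topologicalClosure _

theorem holomorphicTrace_le (j : C(Y, ℂ)) : holomorphicTrace j ≤ uniformHolomorphic j :=
  Subalgebra.le_topologicalClosure _

/-- A character sends `j` to a value of `j`, since otherwise `j` minus that scalar has an inverse in
the trace. At such a point `x`, a holomorphic `g` satisfies `g z - g (j x) = (z - j x) * dslope g (j
x) z` with a holomorphic quotient, so the character is evaluation at `x` on the trace, and on `A` by
continuity. -/
theorem isNaturalAlgebra_of_dense_holomorphicTrace (j : C(Y, ℂ)) (A : Subalgebra ℂ C(Y, ℂ))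
    (hA : IsClosed (A : Set C(Y, ℂ))) (hle : holomorphicTrace j ≤ A)
    (hdense : (A : Set C(Y, ℂ)) ⊆ closure (holomorphicTrace j)) : IsNaturalAlgebra A := by
  intro φ h0 hmul
  obtain ⟨ψ, hψ⟩ : ∃ ψ : A →ₐ[ℂ] ℂ, ∀ f, φ f = ψ f := ⟨characterAlgHom φ h0 hmul, fun _ => rfl⟩
  have hcont : Continuous ψ :=
    AddMonoidHomClass.continuous_of_bound ψ 1 fun f =>
      (norm_character_le hA ψ f).trans_eq (one_mul _).symm
  have hj : j ∈ holomorphicTrace j :=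
    ⟨Set.univ, isOpen_univ, fun _ => trivial, id, differentiableOn_id, fun _ => rfl⟩
  let jA : A := ⟨j, hle hj⟩
  obtain ⟨x, hx⟩ : ∃ x, j x = ψ jA := by
    by_contra! h
    have hinv : ∀ y, j y - ψ jA ≠ 0 := fun y => sub_ne_zero.2 (h y)
    let q : C(Y, ℂ) := ⟨fun y => (j y - ψ jA)⁻¹, by fun_prop (disch := exact hinv _)⟩
    have hq : q ∈ holomorphicTrace j :=
      ⟨{ψ jA}ᶜ, isOpen_compl_singleton, h, fun z => (z - ψ jA)⁻¹,
        fun z hz => DifferentiableAt.differentiableWithinAt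
          (f := fun z => (z - ψ jA)⁻¹) (by fun_prop (disch := exact sub_ne_zero.2 hz)),
        fun _ => rfl⟩
    let qA : A := ⟨q, hle hq⟩
    have : (jA - algebraMap ℂ _ (ψ jA)) * qA = 1 := by
      ext y
      exact mul_inv_cancel₀ (hinv y)
    have h2 := congrArg ψ this
    rw [map_mul, map_sub, AlgHom.commutes] at h2
    simp at h2
  refine ⟨x, fun f => ?_⟩
  rw [hψ]
  have key : ∀ f : C(Y, ℂ), ∀ hf : f ∈ holomorphicTrace j,
      ψ ⟨f, hle hf⟩ = f x := by
    rintro f ⟨U, hU, hjU, g, hg, hfg⟩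
    have hd : DifferentiableOn ℂ (dslope g (j x)) U :=
      (Complex.differentiableOn_dslope (hU.mem_nhds (hjU x))).2 hg
    let q : C(Y, ℂ) := ⟨fun y => dslope g (j x) (j y),
      hd.continuousOn.comp_continuous j.continuous hjU⟩
    have hq : q ∈ holomorphicTrace j := ⟨U, hU, hjU, dslope g (j x), hd, fun _ => rfl⟩
    let qA : A := ⟨q, hle hq⟩
    have : (⟨f, hle ⟨U, hU, hjU, g, hg, hfg⟩⟩ : A)
        = (jA - algebraMap ℂ _ (j x)) * qA + algebraMap ℂ _ (f x) := by
      ext y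
      have := sub_smul_dslope g (j x) (j y)
      rw [smul_eq_mul] at this
      change f y = (j y - j x) * dslope g (j x) (j y) + f x
      rw [this, hfg, hfg]; ring
    rw [this, algHom_sub_mul_add, hx, sub_self, zero_mul, zero_add]
  obtain ⟨f, hf⟩ := f
  have hmem : f ∈ closure (holomorphicTrace j : Set C(Y, ℂ)) := hdense hf
  obtain ⟨u, hu, hlim⟩ := mem_closure_iff_seq_limit.1 hmem
  have h1 : Tendsto (fun n => ψ ⟨u n, hle (hu n)⟩) atTop (𝓝 (ψ ⟨f, hf⟩)) :=
    (hcont.tendsto _).comp (tendsto_subtype_rng.2 hlim)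
  have h2 : Tendsto (fun n => u n x) atTop (𝓝 (f x)) :=
    ((continuous_eval_const (F := C(Y, ℂ)) x).tendsto _).comp hlim
  simp_rw [fun n => key (u n) (hu n)] at h1
  exact tendsto_nhds_unique h1 h2

theorem isNaturalAlgebra_uniformHolomorphic (j : C(Y, ℂ)) :
    IsNaturalAlgebra (uniformHolomorphic j) :=
  isNaturalAlgebra_of_dense_holomorphicTrace j _ (isClosed_uniformHolomorphic j)
    (holomorphicTrace_le j) subset_rfl

end HolomorphicTrace

/-! ### Collapsing a null sequence of disjoint closed sets. -/

section Collapse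

variable {X : Type*} {K : ℕ → Set X}

/-- The equivalence relation collapsing each of the disjoint sets `K m`, `m ∈ S`, to a point. -/
def collapseSetoid (hK : Pairwise (Function.onFun Disjoint K)) (S : Set ℕ) : Setoid X where
  r x y := x = y ∨ ∃ m ∈ S, x ∈ K m ∧ y ∈ K m
  iseqv :=
    { refl := fun _ => Or.inl rfl
      symm := by
        rintro x y (rfl | ⟨m, hm, hx, hy⟩)
        · exact Or.inl rfl
        · exact Or.inr ⟨m, hm, hy, hx⟩
      trans := by
        rintro x y z (rfl | ⟨m, hm, hx, hy⟩) (rfl | ⟨k, hk, hy', hz⟩)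
        · exact Or.inl rfl
        · exact Or.inr ⟨k, hk, hy', hz⟩
        · exact Or.inr ⟨m, hm, hx, hy⟩
        · obtain rfl : m = k := by
            by_contra hne
            exact Set.disjoint_left.1 (hK hne) hy hy'
          exact Or.inr ⟨m, hm, hx, hz⟩ }

/-- The quotient of `X` collapsing each of the disjoint sets `K m`, `m ∈ S`, to a point. -/
abbrev Collapse (hK : Pairwise (Function.onFun Disjoint K)) (S : Set ℕ) : Type _ :=
  Quotient (collapseSetoid hK S)

/-- The projection onto the quotient `Collapse hK S`. -/
def Collapse.mk (hK : Pairwise (Function.onFun Disjoint K)) (S : Set ℕ) (x : X) : Collapse hK S :=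
  Quotient.mk (collapseSetoid hK S) x

theorem Collapse.mk_eq_iff {hK : Pairwise (Function.onFun Disjoint K)} {S : Set ℕ} {x y : X} :
    Collapse.mk hK S x = Collapse.mk hK S y ↔ x = y ∨ ∃ m ∈ S, x ∈ K m ∧ y ∈ K m :=
  Quotient.eq

theorem Collapse.mk_surjective (hK : Pairwise (Function.onFun Disjoint K)) (S : Set ℕ) :
    Function.Surjective (Collapse.mk hK S) := Quotient.mk_surjective

theorem Collapse.continuous_mk [TopologicalSpace X] (hK : Pairwise (Function.onFun Disjoint K))
    (S : Set ℕ) : Continuous (Collapse.mk hK S) := continuous_quotient_mk'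

end Collapse

/-- Disjoint fibres are separated by open sets `U`, `V` of `X`; closedness of `p` makes the points
whose whole fibre lies in `U` (or in `V`) an open set of `Q`. -/
theorem t2Space_of_isClosedMap {X Q : Type*} [TopologicalSpace X] [NormalSpace X]
    [T1Space X] [TopologicalSpace Q] {p : X → Q} (hc : Continuous p) (hs : Function.Surjective p)
    (hp : IsClosedMap p) : T2Space Q := by
  have hsing : ∀ q : Q, IsClosed (p ⁻¹' {q}) := fun q => by
    obtain ⟨x, rfl⟩ := hs q
    rw [← Set.image_singleton]
    exact (hp _ isClosed_singleton).preimage hc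
  refine ⟨fun a b hab => ?_⟩
  obtain ⟨U, V, hU, hV, haU, hbV, hUV⟩ := normal_separation (hsing a) (hsing b)
    (Disjoint.preimage p (Set.disjoint_singleton.2 hab))
  refine ⟨(p '' Uᶜ)ᶜ, (p '' Vᶜ)ᶜ, (hp _ hU.isClosed_compl).isOpen_compl,
    (hp _ hV.isClosed_compl).isOpen_compl, ?_, ?_, ?_⟩
  · rintro ⟨x, hx, hxa⟩
    exact hx (haU hxa)
  · rintro ⟨x, hx, hxb⟩
    exact hx (hbV hxb)
  · refine Set.disjoint_left.2 fun q hq hq' => ?_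
    obtain ⟨x, rfl⟩ := hs q
    have h1 : x ∈ U := by
      by_contra h
      exact hq ⟨x, h, rfl⟩
    have h2 : x ∈ V := by
      by_contra h
      exact hq' ⟨x, h, rfl⟩
    exact Set.disjoint_left.1 hUV h1 h2

theorem exists_eqOn_and_vanish {Q : Type*} [TopologicalSpace Q] [NormalSpace Q] {C D : Set Q}
    (hC : IsClosed C) (hD : IsClosed D) (G : C(Q, ℂ)) (hG : ∀ q ∈ C, q ∈ D → G q = 0) :
    ∃ H : C(Q, ℂ), (∀ q ∈ C, H q = G q) ∧ ∀ q ∈ D, H q = 0 := by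
  classical
  let h : Q → ℂ := fun q => if q ∈ D then 0 else G q
  have h1 : Set.EqOn h G C := fun q hq => by
    by_cases hqD : q ∈ D
    · simp [h, hqD, hG q hq hqD]
    · simp [h, hqD]
  have h2 : Set.EqOn h 0 D := fun q hq => by simp [h, hq]
  have hcont : ContinuousOn h (C ∪ D) :=
    (G.continuous.continuousOn.congr h1).union_of_isClosed
      (continuousOn_const.congr h2) hC hD
  obtain ⟨H, hH⟩ := ContinuousMap.exists_restrict_eq (hC.union hD)
    ⟨(C ∪ D).domRestrict h, hcont.domRestrict⟩
  have hHh : ∀ q ∈ C ∪ D, H q = h q := fun q hq => DFunLike.congr_fun hH ⟨q, hq⟩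
  exact ⟨H, fun q hq => (hHh q (Or.inl hq)).trans (h1 hq),
    fun q hq => (hHh q (Or.inr hq)).trans (h2 hq)⟩

section CollapseTopology

variable {X : Type*} [MetricSpace X] [CompactSpace X] {K : ℕ → Set X}

/-- Near a pair at distance `d > 0`, only sets of diameter at least `d / 2` can identify two points;
these are finitely many, and each contributes a closed product. -/
theorem isClosed_collapse_graph (hcl : ∀ n, IsClosed (K n))
    (hdiam : ∀ ε > 0, {n | ε ≤ Metric.diam (K n)}.Finite) (S : Set ℕ) :
    IsClosed {p : X × X | p.1 = p.2 ∨ ∃ m ∈ S, p.1 ∈ K m ∧ p.2 ∈ K m} := by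
  rw [← isOpen_compl_iff, isOpen_iff_mem_nhds]
  rintro ⟨x, y⟩ hxy
  simp only [Set.mem_compl_iff, Set.mem_ofPred_eq, not_or, not_exists, not_and] at hxy
  obtain ⟨hne, hK⟩ := hxy
  have hd : 0 < dist x y := dist_pos.2 hne
  have hfin : ({n | dist x y / 2 ≤ Metric.diam (K n)} ∩ S).Finite :=
    (hdiam _ (half_pos hd)).inter_of_left S
  have hclosed : IsClosed (⋃ m ∈ {n | dist x y / 2 ≤ Metric.diam (K n)} ∩ S, K m ×ˢ K m) :=
    hfin.isClosed_biUnion fun m _ => (hcl m).prod (hcl m)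
  have hopen : IsOpen {p : X × X | dist x y / 2 < dist p.1 p.2} :=
    isOpen_lt continuous_const continuous_dist
  filter_upwards [hopen.mem_nhds (show dist x y / 2 < dist x y by linarith),
    hclosed.isOpen_compl.mem_nhds (x := (x, y)) (by
      simp only [Set.mem_compl_iff, Set.mem_iUnion, not_exists]
      rintro m ⟨_, hm⟩ ⟨h1, h2⟩
      exact hK m hm h1 h2)] with p hp1 hp2
  rintro (h | ⟨m, hm, h1, h2⟩)
  · rw [h, dist_self] at hp1
    linarith
  · refine hp2 (Set.mem_biUnion (x := m) ⟨?_, hm⟩ ⟨h1, h2⟩)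
    exact hp1.le.trans
      (Metric.dist_le_diam_of_mem (Metric.isBounded_of_compactSpace) h1 h2)

theorem isClosedMap_collapse_mk (hK : Pairwise (Function.onFun Disjoint K))
    (hcl : ∀ n, IsClosed (K n)) (hdiam : ∀ ε > 0, {n | ε ≤ Metric.diam (K n)}.Finite) (S : Set ℕ) :
    IsClosedMap (Collapse.mk hK S) := by
  intro F hF
  have hq : IsQuotientMap (Collapse.mk hK S) := isQuotientMap_quotient_mk'
  rw [← hq.isClosed_preimage]
  -- The saturation of `F` is a projection of a compact part of the graph.
  have : Collapse.mk hK S ⁻¹' (Collapse.mk hK S '' F) = Prod.snd ''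
      ({p : X × X | p.1 = p.2 ∨ ∃ m ∈ S, p.1 ∈ K m ∧ p.2 ∈ K m} ∩ Prod.fst ⁻¹' F) := by
    ext y
    constructor
    · rintro ⟨x, hx, hxy⟩
      exact ⟨(x, y), ⟨Collapse.mk_eq_iff.1 hxy, hx⟩, rfl⟩
    · rintro ⟨⟨x, y'⟩, ⟨hxy, hx⟩, rfl⟩
      exact ⟨x, hx, Collapse.mk_eq_iff.2 hxy⟩
  rw [this]
  exact ((((isClosed_collapse_graph hcl hdiam S).inter
    (hF.preimage continuous_fst)).isCompact).image continuous_snd).isClosed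

theorem t2Space_collapse (hK : Pairwise (Function.onFun Disjoint K))
    (hcl : ∀ n, IsClosed (K n)) (hdiam : ∀ ε > 0, {n | ε ≤ Metric.diam (K n)}.Finite) (S : Set ℕ) :
    T2Space (Collapse hK S) :=
  t2Space_of_isClosedMap (Collapse.continuous_mk hK S) (Collapse.mk_surjective hK S)
    (isClosedMap_collapse_mk hK hcl hdiam S)

/-- A Tietze extension theorem with prescribed zeros and constancy on the sets `K m`, `m ∈ S`. -/
theorem exists_extension_collapse (hK : Pairwise (Function.onFun Disjoint K))
    (hcl : ∀ n, IsClosed (K n)) (hdiam : ∀ ε > 0, {n | ε ≤ Metric.diam (K n)}.Finite) {S : Set ℕ}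
    {C E : Set X} (hC : IsClosed C) (hE : IsClosed E) (hCS : ∀ m ∈ S, Disjoint C (K m))
    (g : C(C, ℂ)) (hg : ∀ x : C, (x : X) ∈ E → g x = 0) :
    ∃ f : C(X, ℂ), (∀ m ∈ S, ∀ x ∈ K m, ∀ y ∈ K m, f x = f y) ∧ (∀ x : C, f x = g x) ∧
      ∀ y ∈ E, f y = 0 := by
  have := t2Space_collapse hK hcl hdiam S
  have hcm := isClosedMap_collapse_mk hK hcl hdiam S
  have hmk : ∀ x ∈ C, ∀ y, Collapse.mk hK S x = Collapse.mk hK S y → x = y := by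
    intro x hx y hxy
    rcases Collapse.mk_eq_iff.1 hxy with h | ⟨m, hm, h1, -⟩
    · exact h
    · exact (Set.disjoint_left.1 (hCS m hm) hx h1).elim
  have : CompactSpace C := isCompact_iff_compactSpace.1 hC.isCompact
  -- `C` misses every collapsed set, so it survives unchanged in the quotient and Tietze's theorem
  -- applies to its image.
  have he : IsClosedEmbedding (fun x : C => Collapse.mk hK S x) :=
    ((Collapse.continuous_mk hK S).comp continuous_subtype_val).isClosedEmbedding
      fun x y h => Subtype.ext (hmk x x.2 y h)
  obtain ⟨G, hG⟩ := ContinuousMap.exists_extension he g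
  replace hG : ∀ x : C, G (Collapse.mk hK S x) = g x := fun x => DFunLike.congr_fun hG x
  obtain ⟨H, hH1, hH2⟩ := exists_eqOn_and_vanish (hcm C hC) (hcm E hE) G (by
    rintro _ ⟨x, hx, rfl⟩ ⟨y, hy, hxy⟩
    obtain rfl := hmk x hx y hxy.symm
    exact (hG ⟨x, hx⟩).trans (hg ⟨x, hx⟩ hy))
  refine ⟨H.comp ⟨Collapse.mk hK S, Collapse.continuous_mk hK S⟩, fun m hm x hx y hy => ?_,
    fun x => ?_, fun y hy => hH2 _ ⟨y, hy, rfl⟩⟩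
  · exact congrArg H (Collapse.mk_eq_iff.2 (Or.inr ⟨m, hm, hx, hy⟩))
  · exact (hH1 _ ⟨x, x.2, rfl⟩).trans (hG x)

end CollapseTopology

/-! ### Gluing algebras along disjoint closed sets. -/

section Glue

variable {X : Type*} [TopologicalSpace X] {K : ℕ → Set X}

/-- The continuous functions on `X` whose restriction to each `K n` belongs to `A n`. -/
def gluedAlgebra (A : ∀ n, Subalgebra ℂ C(K n, ℂ)) : Subalgebra ℂ C(X, ℂ) where
  carrier := {f | ∀ n, f.restrict (K n) ∈ A n}
  mul_mem' hf hg n := (A n).mul_mem (hf n) (hg n)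
  add_mem' hf hg n := (A n).add_mem (hf n) (hg n)
  algebraMap_mem' c n := (A n).algebraMap_mem c

theorem mem_gluedAlgebra {A : ∀ n, Subalgebra ℂ C(K n, ℂ)} {f : C(X, ℂ)} :
    f ∈ gluedAlgebra A ↔ ∀ n, f.restrict (K n) ∈ A n := Iff.rfl

theorem isClosed_gluedAlgebra {A : ∀ n, Subalgebra ℂ C(K n, ℂ)}
    (hA : ∀ n, IsClosed (A n : Set C(K n, ℂ))) :
    IsClosed (gluedAlgebra A : Set C(X, ℂ)) := by
  have : (gluedAlgebra A : Set C(X, ℂ))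
      = ⋂ n, (fun f : C(X, ℂ) => f.restrict (K n)) ⁻¹' (A n : Set C(K n, ℂ)) := by
    ext f
    simp [mem_gluedAlgebra]
  rw [this]
  exact isClosed_iInter fun n => (hA n).preimage (ContinuousMap.continuous_restrict (K n))

theorem restrict_mem_of_const {n : ℕ} {A : Subalgebra ℂ C(K n, ℂ)} {f : C(X, ℂ)}
    (h : ∀ x ∈ K n, ∀ y ∈ K n, f x = f y) : f.restrict (K n) ∈ A := by
  rcases (K n).eq_empty_or_nonempty with he | ⟨x, hx⟩
  · have : f.restrict (K n) = 0 := by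
      ext ⟨y, hy⟩
      simp [he] at hy
    rw [this]
    exact A.zero_mem
  · have : f.restrict (K n) = algebraMap ℂ _ (f x) := by
      ext ⟨y, hy⟩
      exact h y hy x hx
    rw [this]
    exact A.algebraMap_mem _

theorem isEssentialAlgebra_gluedAlgebra [NormalSpace X] (hcl : ∀ n, IsClosed (K n))
    (hdense : ∀ U : Set X, IsOpen U → U.Nonempty → ∃ n, K n ⊆ U)
    {A : ∀ n, Subalgebra ℂ C(K n, ℂ)} (hA : ∀ n, A n ≠ ⊤) :
    IsEssentialAlgebra (gluedAlgebra A) := by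
  refine ⟨⟨isClosed_univ, fun f hf => ?_⟩, ?_⟩
  · have : f = 0 := by
      ext x
      exact hf x trivial
    rw [this]
    exact (gluedAlgebra A).zero_mem
  · rintro F ⟨hF, hFA⟩ x -
    by_contra hx
    obtain ⟨n, hn⟩ := hdense Fᶜ hF.isOpen_compl ⟨x, hx⟩
    refine hA n (eq_top_iff.2 fun g _ => ?_)
    obtain ⟨G, hG⟩ := ContinuousMap.exists_restrict_eq (hcl n) g
    obtain ⟨H, hH1, hH2⟩ := exists_eqOn_and_vanish (hcl n) hF G fun q hq hqF => (hn hq hqF).elim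
    have := hFA H hH2 n
    convert this
    rw [← hG]
    ext y
    exact (hH1 y y.2).symm

theorem exists_eval_of_comp_mem {Q : Type*} [TopologicalSpace Q] [CompactSpace Q]
    [T2Space Q] (p : C(X, Q)) {A : Subalgebra ℂ C(X, ℂ)}
    (hpA : ∀ F : C(Q, ℂ), F.comp p ∈ A) (φ : A →ₐ[ℂ] ℂ) :
    ∃ q, ∀ F : C(Q, ℂ), φ ⟨F.comp p, hpA F⟩ = F q := by
  let ι : C(Q, ℂ) →ₐ[ℂ] A := (ContinuousMap.compRightAlgHom ℂ ℂ p).codRestrict A hpA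
  obtain ⟨q, hq⟩ := (WeakDual.CharacterSpace.continuousMapEval_bijective (X := Q) (𝕜 := ℂ)).2
    (WeakDual.CharacterSpace.equivAlgHom.symm (φ.comp ι))
  exact ⟨q, fun F => (DFunLike.congr_fun hq F).symm⟩

end Glue

section GlueMetric

variable {X : Type*} [MetricSpace X] [CompactSpace X] {K : ℕ → Set X}

/-- All sets except `K n` are collapsed, so the extension is constant on each of them and constants
belong to every `A m`. -/
theorem exists_mem_gluedAlgebra (hK : Pairwise (Function.onFun Disjoint K))
    (hcl : ∀ n, IsClosed (K n)) (hdiam : ∀ ε > 0, {n | ε ≤ Metric.diam (K n)}.Finite)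
    {A : ∀ n, Subalgebra ℂ C(K n, ℂ)} {n : ℕ} {E : Set X} (hE : IsClosed E) {g : C(K n, ℂ)}
    (hgA : g ∈ A n) (hg : ∀ x : K n, (x : X) ∈ E → g x = 0) :
    ∃ f ∈ gluedAlgebra A, f.restrict (K n) = g ∧ ∀ y ∈ E, f y = 0 := by
  obtain ⟨f, h1, h2, h3⟩ := exists_extension_collapse hK hcl hdiam (S := {n}ᶜ) (hcl n) hE
    (fun m hm => hK (Ne.symm hm)) g hg
  have hfg : f.restrict (K n) = g := by
    ext x
    exact h2 x
  refine ⟨f, fun m => ?_, hfg, h3⟩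
  by_cases hm : m = n
  · subst hm
    rwa [hfg]
  · exact restrict_mem_of_const (h1 m hm)

theorem isRegularOnSpace_gluedAlgebra (hK : Pairwise (Function.onFun Disjoint K))
    (hcl : ∀ n, IsClosed (K n)) (hdiam : ∀ ε > 0, {n | ε ≤ Metric.diam (K n)}.Finite)
    {A : ∀ n, Subalgebra ℂ C(K n, ℂ)} (hA : ∀ n, IsRegularOnSpace (A n)) :
    IsRegularOnSpace (gluedAlgebra A) := by
  intro E hE x hx
  by_cases hxK : ∃ n, x ∈ K n
  · obtain ⟨n, hn⟩ := hxK
    obtain ⟨g, hgA, hg1, hg0⟩ := hA n (Subtype.val ⁻¹' E) (hE.preimage continuous_subtype_val)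
      ⟨x, hn⟩ hx
    obtain ⟨f, hf, hfg, hfE⟩ := exists_mem_gluedAlgebra hK hcl hdiam hE hgA hg0
    exact ⟨f, hf, (DFunLike.congr_fun hfg ⟨x, hn⟩).trans hg1, hfE⟩
  · push Not at hxK
    obtain ⟨f, h1, h2, h3⟩ := exists_extension_collapse hK hcl hdiam (S := Set.univ)
      (isClosed_singleton (x := x)) hE (fun m _ => Set.disjoint_singleton_left.2 (hxK m)) 1
      (by rintro ⟨y, rfl⟩ h; exact (hx h).elim)
    exact ⟨f, fun n => restrict_mem_of_const (h1 n trivial), h2 ⟨x, rfl⟩, h3⟩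

/-- Multiplying `f` by a Urysohn function of `Q` that is 1 at `q` and 0 on the image of the set
where `f` has modulus at least `ε` does not change `φ f`, but brings the norm down to `ε`. -/
theorem character_eq_zero_of_vanish_on_fiber {Q : Type*} [TopologicalSpace Q] [CompactSpace Q]
    [T2Space Q] (p : C(X, Q)) (hp : IsClosedMap p) {A : Subalgebra ℂ C(X, ℂ)}
    (hA : IsClosed (A : Set C(X, ℂ))) (hpA : ∀ F : C(Q, ℂ), F.comp p ∈ A) (φ : A →ₐ[ℂ] ℂ) (q : Q)
    (hq : ∀ F : C(Q, ℂ), φ ⟨F.comp p, hpA F⟩ = F q) (f : A)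
    (hf : ∀ x, p x = q → (f : C(X, ℂ)) x = 0) : φ f = 0 := by
  refine norm_le_zero_iff.1 (le_of_forall_pos_le_add fun ε hε => ?_)
  rw [zero_add]
  have hD : IsClosed {x | ε ≤ ‖(f : C(X, ℂ)) x‖} :=
    isClosed_le continuous_const (f : C(X, ℂ)).continuous.norm
  obtain ⟨u, hu0, hu1, hu⟩ := exists_continuous_zero_one_of_isClosed (hp _ hD)
    (isClosed_singleton (x := q)) (by
      rw [Set.disjoint_singleton_right]
      rintro ⟨x, hx, hxq⟩
      rw [Set.mem_ofPred_eq, hf x hxq, norm_zero] at hx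
      exact hε.not_ge hx)
  let F : C(Q, ℂ) := ⟨fun y => (u y : ℂ), by fun_prop⟩
  have hFq : F q = 1 := by simp [F, hu1 rfl]
  have h1 : φ f = φ (f * ⟨F.comp p, hpA F⟩) := by rw [map_mul φ, hq, hFq, mul_one]
  rw [h1]
  refine (norm_character_le hA φ _).trans ?_
  change ‖(f : C(X, ℂ)) * F.comp p‖ ≤ ε
  rw [ContinuousMap.norm_le _ hε.le]
  intro x
  rw [ContinuousMap.mul_apply, norm_mul]
  have hux : ‖F.comp p x‖ = u (p x) := by
    change ‖(u (p x) : ℂ)‖ = _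
    rw [Complex.norm_real, Real.norm_of_nonneg (hu _).1]
  rw [hux]
  by_cases hx : ε ≤ ‖(f : C(X, ℂ)) x‖
  · rw [hu0 ⟨x, hx, rfl⟩]
    simpa using hε.le
  · exact (mul_le_of_le_one_right (norm_nonneg _) (hu _).2).trans (not_le.1 hx).le

theorem isNaturalAlgebra_gluedAlgebra (hK : Pairwise (Function.onFun Disjoint K))
    (hcl : ∀ n, IsClosed (K n)) (hdiam : ∀ ε > 0, {n | ε ≤ Metric.diam (K n)}.Finite)
    {A : ∀ n, Subalgebra ℂ C(K n, ℂ)} (hAcl : ∀ n, IsClosed (A n : Set C(K n, ℂ)))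
    (hA : ∀ n, IsNaturalAlgebra (A n)) : IsNaturalAlgebra (gluedAlgebra A) := by
  intro φ h0 hmul
  obtain ⟨ψ, hψ⟩ : ∃ ψ : gluedAlgebra A →ₐ[ℂ] ℂ, ∀ f, φ f = ψ f :=
    ⟨characterAlgHom φ h0 hmul, fun _ => rfl⟩
  have := t2Space_collapse hK hcl hdiam Set.univ
  let p : C(X, Collapse hK Set.univ) := ⟨Collapse.mk hK Set.univ, Collapse.continuous_mk hK _⟩
  have hpA : ∀ F : C(Collapse hK Set.univ, ℂ), F.comp p ∈ gluedAlgebra A := fun F n =>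
    restrict_mem_of_const fun x hx y hy =>
      congrArg F (Collapse.mk_eq_iff.2 (Or.inr ⟨n, trivial, hx, hy⟩))
  obtain ⟨q, hq⟩ := exists_eval_of_comp_mem p hpA ψ
  have hvan := character_eq_zero_of_vanish_on_fiber p (isClosedMap_collapse_mk hK hcl hdiam _)
    (isClosed_gluedAlgebra hAcl) hpA ψ q hq
  obtain ⟨x₀, rfl⟩ := Collapse.mk_surjective hK Set.univ q
  by_cases hx : ∃ n, x₀ ∈ K n
  · obtain ⟨n, hn⟩ := hx
    have heq : ∀ f f' : gluedAlgebra A,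
        (f : C(X, ℂ)).restrict (K n) = (f' : C(X, ℂ)).restrict (K n) → φ f = φ f' := by
      intro f f' hff
      rw [hψ, hψ, ← sub_eq_zero, ← map_sub ψ]
      refine hvan _ fun x hxx => ?_
      have hxn : x ∈ K n := by
        rcases Collapse.mk_eq_iff.1 hxx with rfl | ⟨m, -, h1, h2⟩
        · exact hn
        · obtain rfl : m = n := by
            by_contra hne
            exact Set.disjoint_left.1 (hK hne) h2 hn
          exact h1
      exact sub_eq_zero.2 (DFunLike.congr_fun hff ⟨x, hxn⟩)
    have hext : ∀ g : A n, ∃ f : gluedAlgebra A, (f : C(X, ℂ)).restrict (K n) = g := fun g => by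
      obtain ⟨f, hf, hfg, -⟩ := exists_mem_gluedAlgebra hK hcl hdiam (A := A) isClosed_empty g.2
        (by simp)
      exact ⟨⟨f, hf⟩, hfg⟩
    -- The lift `e` need not be linear or multiplicative, but two lifts of the same function differ
    -- by one vanishing on `K n`, which `φ` kills. Hence `φ ∘ e` is a character of `A n`.
    choose e he using hext
    let φ' : A n →ₗ[ℂ] ℂ :=
      { toFun := fun g => φ (e g)
        map_add' := fun g g' => by
          refine Eq.trans (heq _ _ ?_) (φ.map_add (e g) (e g'))
          refine ((he _).trans ?_)
          rw [Subalgebra.coe_add, ← he g, ← he g']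
          rfl
        map_smul' := fun c g => by
          refine Eq.trans (heq _ _ ?_) (φ.map_smul c (e g))
          refine ((he _).trans ?_)
          rw [Subalgebra.coe_smul, ← he g]
          rfl }
    have hmul' : ∀ g g' : A n, φ' (g * g') = φ' g * φ' g' := fun g g' => by
      change φ _ = φ _ * φ _
      rw [← hmul]
      refine heq _ _ ((he _).trans ?_)
      rw [Subalgebra.coe_mul, ← he g, ← he g']
      rfl
    have hone : φ' 1 = 1 := by
      change φ _ = 1
      rw [← map_one ψ, ← hψ]
      exact heq _ _ ((he _).trans rfl)
    obtain ⟨x, hx⟩ := hA n φ' (fun h => by simp [h] at hone) hmul'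
    refine ⟨x, fun f => ?_⟩
    rw [heq f (e ⟨_, f.2 n⟩) (he ⟨_, f.2 n⟩).symm]
    exact hx ⟨_, f.2 n⟩
  · push Not at hx
    refine ⟨x₀, fun f => ?_⟩
    have h := hvan (f - algebraMap ℂ _ ((f : C(X, ℂ)) x₀)) fun x hxx => by
      rcases Collapse.mk_eq_iff.1 hxx with rfl | ⟨m, -, -, h2⟩
      · exact sub_self _
      · exact (hx m h2).elim
    rw [map_sub ψ, AlgHom.commutes, sub_eq_zero] at h
    rw [hψ]
    exact h

end GlueMetric

/-! ### McKissick's discs, from products of rational functions. -/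

/-- `f` is on `S` a uniform limit of functions holomorphic near `S`. -/
def IsHolomorphicLimit (S : Set ℂ) (f : ℂ → ℂ) : Prop :=
  ∀ δ > 0, ∃ V : Set ℂ, IsOpen V ∧ S ⊆ V ∧ ∃ g : ℂ → ℂ, DifferentiableOn ℂ g V ∧
    ∀ z ∈ S, ‖f z - g z‖ < δ

/-- Removing `N` discs keeps `1 - u ^ N` away from 0, at a total radius `3 * η` that does not depend
on `N`. The principal branch gives an `N`-th root `v` of `u ^ N` near 1, and `u / v` is a root of
unity. -/
theorem exists_root_near {N : ℕ} (hN : 1 ≤ N) {η : ℝ} (hη : η ≤ 1 / 2) {u : ℂ}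
    (hu : ‖1 - u ^ N‖ < η) :
    ∃ j < N, ‖u - Complex.exp (2 * Real.pi * Complex.I / N) ^ j‖ < 3 * η / N := by
  have hN0 : (N : ℂ) ≠ 0 := by exact_mod_cast (by lia : N ≠ 0)
  have hNR : (1 : ℝ) ≤ N := by exact_mod_cast hN
  set ζ := u ^ N - 1 with hζ
  have hζη : ‖ζ‖ < η := by rwa [hζ, norm_sub_rev]
  have hlog := Complex.norm_log_one_add_half_le_self (hζη.le.trans hη)
  have hne : 1 + ζ ≠ 0 := by
    intro h
    have h1 : ζ = -1 := by linear_combination h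
    rw [h1, norm_neg, norm_one] at hζη
    linarith
  set v := Complex.exp (Complex.log (1 + ζ) / N) with hv
  have hvN : v ^ N = u ^ N := by
    rw [hv, ← Complex.exp_nat_mul, mul_div_cancel₀ _ hN0, Complex.exp_log hne, hζ]
    ring
  have hv0 : v ≠ 0 := Complex.exp_ne_zero _
  have hw : (u / v) ^ N = 1 := by
    rw [div_pow, hvN, div_self]
    rw [← hvN]
    exact pow_ne_zero _ hv0
  have : NeZero N := ⟨by lia⟩
  obtain ⟨j, hj, hjw⟩ :=
    (Complex.isPrimitiveRoot_exp N (by lia)).eq_pow_of_pow_eq_one hw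
  refine ⟨j, hj, ?_⟩
  have hnorm : ‖u / v‖ = 1 := Complex.norm_eq_one_of_pow_eq_one hw (by lia)
  rw [hjw, show u - u / v = u / v * (v - 1) by field_simp, norm_mul, hnorm, one_mul]
  have hlogN : ‖Complex.log (1 + ζ) / N‖ = ‖Complex.log (1 + ζ)‖ / N := by
    rw [norm_div, Complex.norm_natCast]
  have hle : ‖Complex.log (1 + ζ) / N‖ ≤ 1 := by
    rw [hlogN]
    exact (div_le_self (norm_nonneg _) hNR).trans (by linarith)
  calc ‖v - 1‖ ≤ 2 * ‖Complex.log (1 + ζ) / N‖ := Complex.norm_exp_sub_one_le hle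
    _ = 2 * ‖Complex.log (1 + ζ)‖ / N := by rw [hlogN]; ring
    _ < 3 * η / N := div_lt_div_of_pos_right (by linarith) (by linarith)

/-- With its companion for large `‖z‖`, this says that for large `N` the rational factor is close to
the indicator function of the disc of radius `ρ`. -/
theorem eventually_inv_one_sub_pow_near_one {σ ρ e : ℝ} (hσ : 0 ≤ σ) (hσρ : σ < ρ) (he : 0 < e) :
    ∀ᶠ N : ℕ in atTop, ∀ z : ℂ, ‖z‖ ≤ σ → ‖(1 - (z / ρ) ^ N)⁻¹ - 1‖ ≤ e := by
  have hρ : 0 < ρ := hσ.trans_lt hσρ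
  have hlim := tendsto_pow_atTop_nhds_zero_of_lt_one (r := σ / ρ) (by positivity)
    ((div_lt_one hρ).2 hσρ)
  filter_upwards [hlim.eventually_le_const (u := min (1 / 2) (e / 2)) (by positivity)]
    with N hN z hz
  have hw : ‖(z / ρ) ^ N‖ ≤ min (1 / 2) (e / 2) := by
    refine le_trans ?_ hN
    rw [norm_pow, norm_div, Complex.norm_real, Real.norm_of_nonneg hρ.le]
    gcongr
  set w := (z / ρ) ^ N
  have h1 : ‖w‖ ≤ 1 / 2 := hw.trans (min_le_left _ _)
  have h2 : ‖w‖ ≤ e / 2 := hw.trans (min_le_right _ _)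
  have h3 : 1 / 2 ≤ ‖1 - w‖ := by
    have := norm_sub_norm_le 1 w
    rw [norm_one] at this
    linarith
  have h4 : 1 - w ≠ 0 := fun h => by rw [h, norm_zero] at h3; linarith
  rw [show (1 - w)⁻¹ - 1 = w / (1 - w) by field_simp; ring, norm_div,
    div_le_iff₀ (by linarith)]
  nlinarith

theorem eventually_inv_one_sub_pow_small {τ ρ e : ℝ} (hρ : 0 < ρ) (hρτ : ρ < τ) (he : 0 < e) :
    ∀ᶠ N : ℕ in atTop, ∀ z : ℂ, τ ≤ ‖z‖ → ‖(1 - (z / ρ) ^ N)⁻¹‖ ≤ e := by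
  have hlim := tendsto_pow_atTop_atTop_of_one_lt ((one_lt_div hρ).2 hρτ)
  filter_upwards [hlim.eventually_ge_atTop (1 + e⁻¹)] with N hN z hz
  have hw : 1 + e⁻¹ ≤ ‖(z / ρ) ^ N‖ := by
    refine hN.trans ?_
    rw [norm_pow, norm_div, Complex.norm_real, Real.norm_of_nonneg hρ.le]
    have := hρ.trans hρτ
    gcongr
  have h := norm_sub_norm_le ((z / ρ) ^ N) 1
  rw [norm_one, norm_sub_rev] at h
  rw [norm_inv]
  exact inv_le_of_inv_le₀ he (by linarith)

section PartialProducts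

variable {η σ : ℕ → ℝ} {h : ℕ → ℂ → ℂ}

/-- Bounds on the factors `h n` on `S`: they are uniformly bounded, very close to `1` for
`‖z‖ ≤ σ n` and very small for `σ (n + 1) ≤ ‖z‖`. -/
structure FactorBounds (η σ : ℕ → ℝ) (h : ℕ → ℂ → ℂ) (S : Set ℂ) : Prop where
  pos : ∀ n, 0 < η n
  le_half : ∀ n, η n ≤ 1 / 2
  bound : ∀ n, ∀ z ∈ S, ‖h n z‖ ≤ (η n)⁻¹
  near_one : ∀ n, ∀ z ∈ S, ‖z‖ ≤ σ n →
    ‖h n z - 1‖ ≤ (1 / 2) ^ n * ∏ k ∈ Finset.range (n + 2), η k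
  small : ∀ n, ∀ z ∈ S, σ (n + 1) ≤ ‖z‖ →
    ‖h n z‖ ≤ (1 / 2) ^ n * ∏ k ∈ Finset.range (n + 2), η k

namespace FactorBounds

variable {S : Set ℂ}

theorem norm_prod_le (B : FactorBounds η σ h S) (n : ℕ) {z : ℂ} (hz : z ∈ S) :
    ‖∏ k ∈ Finset.range n, h k z‖ ≤ (∏ k ∈ Finset.range n, η k)⁻¹ := by
  rw [norm_prod, ← Finset.prod_inv_distrib]
  exact Finset.prod_le_prod (fun _ _ => norm_nonneg _) fun k _ => B.bound k z hz

/-- The error allowed at stage `n` absorbs the possible growth of all earlier factors and leaves `η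
n * η (n + 1)` to spare; the second of these pays for the next factor. -/
theorem inv_prod_mul (B : FactorBounds η σ h S) (n : ℕ) :
    (∏ k ∈ Finset.range n, η k)⁻¹ * ((1 / 2) ^ n * ∏ k ∈ Finset.range (n + 2), η k)
      = (1 / 2) ^ n * (η n * η (n + 1)) := by
  rw [Finset.prod_range_succ, Finset.prod_range_succ]
  have : ∏ k ∈ Finset.range n, η k ≠ 0 := Finset.prod_ne_zero_iff.2 fun k _ => (B.pos k).ne'
  field_simp

theorem norm_prod_succ_le (B : FactorBounds η σ h S) (n : ℕ) {z : ℂ} (hz : z ∈ S)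
    (hσ : σ (n + 1) ≤ ‖z‖) :
    ‖∏ k ∈ Finset.range (n + 1), h k z‖ ≤ (1 / 2) ^ n * (η n * η (n + 1)) := by
  rw [Finset.prod_range_succ, norm_mul, ← B.inv_prod_mul n]
  have := Finset.prod_pos fun k (_ : k ∈ Finset.range n) => B.pos k
  exact mul_le_mul (B.norm_prod_le n hz) (B.small n z hz hσ) (norm_nonneg _) (by positivity)

theorem norm_step_le (B : FactorBounds η σ h S) (m : ℕ) {z : ℂ} (hz : z ∈ S) :
    ‖∏ k ∈ Finset.range (m + 2), h k z - ∏ k ∈ Finset.range (m + 1), h k z‖ ≤ (1 / 2) ^ m := by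
  have e1 := B.pos m
  have e2 := B.pos (m + 1)
  have e3 := B.pos (m + 2)
  have e1' := B.le_half m
  have e2' := B.le_half (m + 1)
  have e3' := B.le_half (m + 2)
  have hp : (0 : ℝ) < (1 / 2) ^ m := by positivity
  rw [Finset.prod_range_succ (fun k => h k z) (m + 1), ← mul_sub_one, norm_mul]
  -- Either the new factor is close to 1, or the previous factor has already made the product tiny.
  rcases le_total ‖z‖ (σ (m + 1)) with hσ | hσ
  · have h1 := mul_le_mul (B.norm_prod_le (m + 1) hz) (B.near_one (m + 1) z hz hσ)
      (norm_nonneg _) (inv_nonneg.2 (Finset.prod_nonneg fun k _ => (B.pos k).le))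
    rw [B.inv_prod_mul (m + 1)] at h1
    refine h1.trans ?_
    rw [pow_succ]
    have : η (m + 1) * η (m + 2) ≤ 1 := by nlinarith
    nlinarith
  · have h2 : ‖h (m + 1) z - 1‖ ≤ 2 * (η (m + 1))⁻¹ := by
      have h3 := norm_sub_le (h (m + 1) z) 1
      have h4 := B.bound (m + 1) z hz
      have h5 : 1 ≤ (η (m + 1))⁻¹ := (one_le_inv₀ e2).2 (by linarith)
      rw [norm_one] at h3
      linarith
    calc _ ≤ (1 / 2) ^ m * (η m * η (m + 1)) * (2 * (η (m + 1))⁻¹) :=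
          mul_le_mul (B.norm_prod_succ_le m hz hσ) h2 (norm_nonneg _) (by positivity)
      _ = (1 / 2) ^ m * (2 * η m) := by field_simp
      _ ≤ (1 / 2) ^ m := mul_le_of_le_one_right hp.le (by linarith)

theorem exists_limit (B : FactorBounds η σ h S) : ∃ f : ℂ → ℂ,
    TendstoUniformlyOn (fun n z => ∏ k ∈ Finset.range (n + 1), h k z) f atTop S := by
  have h1 := tendstoUniformlyOn_tsum_nat (s := S) summable_geometric_two
    (f := fun m z => ∏ k ∈ Finset.range (m + 2), h k z - ∏ k ∈ Finset.range (m + 1), h k z)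
    fun m z hz => B.norm_step_le m hz
  refine ⟨fun z => (∑' m, (∏ k ∈ Finset.range (m + 2), h k z -
    ∏ k ∈ Finset.range (m + 1), h k z)) + h 0 z, ?_⟩
  rw [Metric.tendstoUniformlyOn_iff] at h1 ⊢
  intro ε hε
  filter_upwards [h1 ε hε] with n hn z hz
  have h2 := hn z hz
  rw [Finset.sum_range_sub (fun m => ∏ k ∈ Finset.range (m + 1), h k z)] at h2
  rw [dist_eq_norm] at h2 ⊢
  convert h2 using 2
  simp
  ring

theorem limit_eq_zero (B : FactorBounds η σ h S) {f : ℂ → ℂ} {z : ℂ} (hz : z ∈ S)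
    (hσ : ∀ n, σ n ≤ ‖z‖)
    (hf : Tendsto (fun n => ∏ k ∈ Finset.range (n + 1), h k z) atTop (𝓝 (f z))) : f z = 0 := by
  refine tendsto_nhds_unique hf (squeeze_zero_norm (fun n => ?_)
    (tendsto_pow_atTop_nhds_zero_of_lt_one (r := (1 / 2 : ℝ)) (by norm_num) (by norm_num)))
  refine (B.norm_prod_succ_le n hz (hσ _)).trans (mul_le_of_le_one_right (by positivity) ?_)
  have := B.pos n
  have := B.pos (n + 1)
  have := B.le_half n
  have := B.le_half (n + 1)
  nlinarith

theorem norm_sub_one_le (B : FactorBounds η σ h S) (n : ℕ) {z : ℂ} (hz : z ∈ S) (hσ : ‖z‖ ≤ σ n) :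
    ‖h n z - 1‖ ≤ (1 / 2) ^ n * (1 / 4) := by
  refine (B.near_one n z hz hσ).trans (mul_le_mul_of_nonneg_left ?_ (by positivity))
  rw [Finset.prod_range_succ, Finset.prod_range_succ]
  have h1 : ∏ k ∈ Finset.range n, η k ≤ 1 :=
    Finset.prod_le_one (fun k _ => (B.pos k).le) fun k _ => (B.le_half k).trans (by norm_num)
  have h0 : 0 ≤ ∏ k ∈ Finset.range n, η k := Finset.prod_nonneg fun k _ => (B.pos k).le
  have e1 := B.pos n
  have e2 := B.pos (n + 1)
  have e1' := B.le_half n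
  have e2' := B.le_half (n + 1)
  calc _ ≤ 1 * (1 / 2) * (1 / 2 : ℝ) := by gcongr
    _ = 1 / 4 := by norm_num

theorem limit_ne_zero (B : FactorBounds η σ h S) {f : ℂ → ℂ} {z : ℂ} (hz : z ∈ S)
    (hne : ∀ n, h n z ≠ 0) {m : ℕ}
    (hσ : ∀ n, m ≤ n → ‖z‖ ≤ σ n)
    (hf : Tendsto (fun n => ∏ k ∈ Finset.range (n + 1), h k z) atTop (𝓝 (f z))) : f z ≠ 0 := by
  set F : ℕ → ℂ := fun n => ∏ k ∈ Finset.range n, h k z with hF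
  have hf' : Tendsto F atTop (𝓝 (f z)) := (tendsto_add_atTop_iff_nat 1).1 hf
  have hFm : 0 < ‖F m‖ := norm_pos_iff.2 (Finset.prod_ne_zero_iff.2 fun k _ => hne k)
  -- From index `m` on, the factors are within `(1 / 2) ^ n / 4` of 1, so the product loses at most
  -- half its modulus.
  have key : ∀ k, ‖F m‖ * (1 / 2 + (1 / 2) ^ (k + 1)) ≤ ‖F (m + k)‖ := by
    intro k
    induction k with
    | zero => norm_num
    | succ k ih =>
      have h1 : F (m + (k + 1)) = F (m + k) * h (m + k) z := Finset.prod_range_succ _ _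
      have h2 := B.norm_sub_one_le (m + k) hz (hσ _ (by lia))
      have h3 : 1 - ‖h (m + k) z - 1‖ ≤ ‖h (m + k) z‖ := by
        have := norm_sub_norm_le 1 (1 - h (m + k) z)
        rw [norm_one, sub_sub_cancel, norm_sub_rev] at this
        exact this
      have h4 : (1 / 2 : ℝ) ^ (m + k) ≤ (1 / 2) ^ k :=
        pow_le_pow_of_le_one (by norm_num) (by norm_num) (by lia)
      have h5 : (0 : ℝ) < (1 / 2) ^ k := by positivity
      have h6 : (1 / 2 : ℝ) ^ k ≤ 1 := pow_le_one₀ (by norm_num) (by norm_num)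
      have h7 : 1 - (1 / 2 : ℝ) ^ k / 4 ≤ ‖h (m + k) z‖ := by linarith
      rw [h1, norm_mul]
      refine le_trans ?_ (mul_le_mul ih h7 (by linarith) (norm_nonneg _))
      rw [mul_assoc]
      refine mul_le_mul_of_nonneg_left ?_ hFm.le
      rw [pow_succ, pow_succ]
      nlinarith
  intro h0
  rw [h0] at hf'
  have h1 := (hf'.comp (tendsto_add_atTop_nat m)).norm
  rw [norm_zero] at h1
  have h2 : ‖F m‖ / 2 ≤ 0 := by
    refine ge_of_tendsto' h1 fun k => ?_
    have := key k
    have h5 : (0 : ℝ) < (1 / 2) ^ (k + 1) := by positivity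
    simp only [Function.comp_apply]
    rw [add_comm k m]
    nlinarith
  linarith

end FactorBounds

end PartialProducts

/-- Small discs whose removal allows a non-zero function on `D` vanishing off `D` to be
uniformly approximated by holomorphic functions. -/
structure IsCheeseFamily {ι : Type} (c : ι → ℂ) (r : ι → ℝ) (D : Set ℂ) (f : ℂ → ℂ) : Prop where
  pos : ∀ i, 0 < r i
  center_mem : ∃ i, c i ∈ D
  limit : IsHolomorphicLimit (⋃ i, Metric.ball (c i) (r i))ᶜ f
  ne_zero : ∀ z ∈ D, z ∉ ⋃ i, Metric.ball (c i) (r i) → f z ≠ 0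
  eq_zero : ∀ z, z ∉ D → z ∉ ⋃ i, Metric.ball (c i) (r i) → f z = 0

theorem isHolomorphicLimit_of_tendsto_prod_inv {S : Set ℂ} {p : ℕ → ℂ → ℂ}
    (hp : ∀ n, Differentiable ℂ (p n)) (hpS : ∀ n, ∀ z ∈ S, p n z ≠ 0) {f : ℂ → ℂ}
    (hf : TendstoUniformlyOn (fun n z => ∏ k ∈ Finset.range (n + 1), (p k z)⁻¹) f atTop S) :
    IsHolomorphicLimit S f := by
  intro δ hδ
  obtain ⟨n, hn⟩ := ((Metric.tendstoUniformlyOn_iff.1 hf) δ hδ).exists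
  refine ⟨⋂ k ∈ Finset.range (n + 1), {z | p k z ≠ 0},
    isOpen_biInter_finset fun k _ => isOpen_ne_fun (hp k).continuous continuous_const,
    fun z hz => Set.mem_iInter₂.2 fun k _ => hpS k z hz,
    fun z => ∏ k ∈ Finset.range (n + 1), (p k z)⁻¹, ?_, fun z hz => ?_⟩
  · refine DifferentiableOn.fun_finsetProd fun k hk z hz =>
      ((hp k z).fun_inv (Set.mem_iInter₂.1 hz k hk)).differentiableWithinAt
  · rw [← dist_eq_norm]
    exact hn z hz

theorem exists_cheeseFamily_unit {ε : ℝ} (hε : 0 < ε) : ∃ (ι : Type) (c : ι → ℂ) (r : ι → ℝ)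
    (f : ℂ → ℂ), IsCheeseFamily c r (Metric.ball 0 1) f ∧
      ∑' i, ENNReal.ofReal (r i) ≤ ENNReal.ofReal ε := by
  set ε' := min ε 1 with hε'
  have hε'0 : 0 < ε' := by positivity
  have hε'1 : ε' ≤ 1 := min_le_right _ _
  -- Stage `n` removes `N n` discs of radius `3 * η n / N n`; the stages sum to `ε'`.
  let η : ℕ → ℝ := fun n => ε' / 6 * (1 / 2) ^ n
  have hη0 : ∀ n, 0 < η n := fun n => by positivity
  have hη1 : ∀ n, η n ≤ 1 / 2 := fun n => by
    have : (1 / 2 : ℝ) ^ n ≤ 1 := pow_le_one₀ (by norm_num) (by norm_num)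
    have : 0 < (1 / 2 : ℝ) ^ n := by positivity
    simp only [η]
    nlinarith
  -- Radii increasing to 1: poles of the factors lie on circles of odd index, and the even indices
  -- bound the regions where a factor is near 1 or near 0.
  let a : ℕ → ℝ := fun n => 1 - 1 / (n + 2)
  have ha0 : ∀ n, 0 < a n := fun n => by
    simp only [a]
    rw [sub_pos, div_lt_one (by positivity)]
    have : (0 : ℝ) ≤ n := n.cast_nonneg
    linarith
  have ha1 : ∀ n, a n < 1 := fun n => by
    simp only [a]
    have : (0 : ℝ) < 1 / (n + 2) := by positivity
    linarith
  have hamono : StrictMono a := strictMono_nat_of_lt_succ fun n => by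
    simp only [a]
    refine sub_lt_sub_left (one_div_lt_one_div_of_lt (by positivity) ?_) _
    push_cast
    linarith
  have halim : Tendsto a atTop (𝓝 1) := by
    have h1 : Tendsto (fun n : ℕ => 1 / ((n + 1 : ℕ) + 1 : ℝ)) atTop (𝓝 0) :=
      (tendsto_add_atTop_iff_nat 1).2 tendsto_one_div_add_atTop_nhds_zero_nat
    have h2 := h1.const_sub 1
    rw [sub_zero] at h2
    refine h2.congr fun n => ?_
    simp only [a]
    push_cast
    ring
  let e : ℕ → ℝ := fun n => (1 / 2) ^ n * ∏ k ∈ Finset.range (n + 2), η k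
  have he : ∀ n, 0 < e n := fun n =>
    mul_pos (by positivity) (Finset.prod_pos fun k _ => hη0 k)
  -- `N n` is chosen after all the `η k`; a large value costs nothing in total radius.
  have hN : ∀ n, ∃ N : ℕ, 1 ≤ N ∧
      (∀ z : ℂ, ‖z‖ ≤ a (2 * n) → ‖(1 - (z / (a (2 * n + 1) : ℝ)) ^ N)⁻¹ - 1‖ ≤ e n) ∧
      ∀ z : ℂ, a (2 * (n + 1)) ≤ ‖z‖ → ‖(1 - (z / (a (2 * n + 1) : ℝ)) ^ N)⁻¹‖ ≤ e n := fun n =>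
    ((eventually_ge_atTop 1).and
      ((eventually_inv_one_sub_pow_near_one (ha0 _).le (hamono (by lia)) (he n)).and
        (eventually_inv_one_sub_pow_small (ha0 _) (hamono (by lia)) (he n)))).exists
  choose N hN1 hN2 hN3 using hN
  let p : ℕ → ℂ → ℂ := fun n z => 1 - (z / (a (2 * n + 1) : ℝ)) ^ N n
  let c : (Σ n, Fin (N n)) → ℂ := fun i =>
    a (2 * i.1 + 1) * Complex.exp (2 * Real.pi * Complex.I / N i.1) ^ (i.2 : ℕ)
  let r : (Σ n, Fin (N n)) → ℝ := fun i => 3 * η i.1 / N i.1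
  have hNpos : ∀ n, (0 : ℝ) < N n := fun n => by exact_mod_cast hN1 n
  set U := ⋃ i, Metric.ball (c i) (r i) with hU
  have hfar : ∀ n, ∀ z ∈ Uᶜ, η n ≤ ‖p n z‖ := by
    intro n z hz
    by_contra! hlt
    obtain ⟨j, hj, hjz⟩ := exists_root_near (hN1 n) (hη1 n) hlt
    refine hz (Set.mem_iUnion.2 ⟨⟨n, j, hj⟩, ?_⟩)
    rw [Metric.mem_ball, dist_eq_norm]
    have hane : ((a (2 * n + 1) : ℝ) : ℂ) ≠ 0 := by exact_mod_cast (ha0 _).ne'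
    have hza : z = (a (2 * n + 1) : ℝ) * (z / (a (2 * n + 1) : ℝ)) := by field_simp
    simp only [c, r]
    rw [hza, ← mul_sub, norm_mul, Complex.norm_real, Real.norm_of_nonneg (ha0 _).le]
    exact (mul_le_of_le_one_left (norm_nonneg _) (ha1 _).le).trans_lt hjz
  have hp0 : ∀ n, ∀ z ∈ Uᶜ, p n z ≠ 0 := fun n z hz h0 => by
    have := hfar n z hz
    rw [h0, norm_zero] at this
    exact (hη0 n).not_ge this
  have B : FactorBounds η (fun n => a (2 * n)) (fun n z => (p n z)⁻¹) Uᶜ :=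
    { pos := hη0
      le_half := hη1
      bound := fun n z hz => by
        rw [norm_inv]
        exact inv_anti₀ (hη0 n) (hfar n z hz)
      near_one := fun n z _ hσ => hN2 n z hσ
      small := fun n z _ hσ => hN3 n z hσ }
  obtain ⟨f, hf⟩ := B.exists_limit
  refine ⟨Σ n, Fin (N n), c, r, f, ⟨fun i => ?_, ⟨⟨0, 0, hN1 0⟩, ?_⟩,
    isHolomorphicLimit_of_tendsto_prod_inv (fun n => by fun_prop) hp0 hf,
    fun z hz hzU => ?_, fun z hz hzU => ?_⟩, ?_⟩
  · have := hη0 i.1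
    have := hNpos i.1
    simp only [r]
    positivity
  · simp only [c, mem_ball_zero_iff, pow_zero, mul_one, Complex.norm_real]
    rw [Real.norm_of_nonneg (ha0 _).le]
    exact ha1 _
  · obtain ⟨m, hm⟩ := (halim.eventually_const_lt (mem_ball_zero_iff.1 hz)).exists
    refine B.limit_ne_zero hzU (fun n => inv_ne_zero (hp0 n z hzU)) (m := m) (fun n hn => ?_)
      (hf.tendsto_at hzU)
    exact hm.le.trans (hamono.monotone (by lia))
  · rw [mem_ball_zero_iff, not_lt] at hz
    exact B.limit_eq_zero hzU (fun n => (ha1 _).le.trans hz) (hf.tendsto_at hzU)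
  · rw [ENNReal.tsum_sigma']
    have h1 : ∀ n, ∑' j : Fin (N n), ENNReal.ofReal (r ⟨n, j⟩)
        = ENNReal.ofReal (ε' / 2 * (1 / 2) ^ n) := by
      intro n
      rw [tsum_fintype]
      simp only [r, Finset.sum_const, Finset.card_univ, Fintype.card_fin]
      rw [← ENNReal.ofReal_nsmul, nsmul_eq_mul]
      congr 1
      simp only [η]
      field_simp [(hNpos n).ne']
      norm_num
    simp_rw [h1]
    rw [← ENNReal.ofReal_tsum_of_nonneg (fun n => by positivity)
      (summable_geometric_two.mul_left _), tsum_mul_left, tsum_geometric_two]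
    exact ENNReal.ofReal_le_ofReal (by linarith [min_le_left ε 1])

theorem exists_cheeseFamily (a : ℂ) {R ε : ℝ} (hR : 0 < R) (hε : 0 < ε) :
    ∃ (ι : Type) (c : ι → ℂ) (r : ι → ℝ) (f : ℂ → ℂ), IsCheeseFamily c r (Metric.ball a R) f ∧
      ∑' i, ENNReal.ofReal (r i) ≤ ENNReal.ofReal ε := by
  obtain ⟨ι, c, r, f, hF, hsum⟩ := exists_cheeseFamily_unit (div_pos hε hR)
  have hRC : (R : ℂ) ≠ 0 := by exact_mod_cast hR.ne'
  have hball : ∀ z w : ℂ, ∀ s : ℝ, z ∈ Metric.ball (a + R * w) (R * s) ↔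
      (z - a) / R ∈ Metric.ball w s := fun z w s => by
    rw [Metric.mem_ball, Metric.mem_ball, dist_eq_norm, dist_eq_norm,
      show z - (a + R * w) = R * ((z - a) / R - w) by field_simp; ring, norm_mul,
      Complex.norm_real, Real.norm_of_nonneg hR.le, mul_lt_mul_iff_right₀ hR]
  have hU : ∀ z, z ∈ ⋃ i, Metric.ball (a + R * c i) (R * r i) ↔
      (z - a) / R ∈ ⋃ i, Metric.ball (c i) (r i) := fun z => by
    simp only [Set.mem_iUnion, hball]
  have hD : ∀ z, z ∈ Metric.ball a R ↔ (z - a) / R ∈ Metric.ball (0 : ℂ) 1 := fun z => by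
    rw [← hball]
    simp
  refine ⟨ι, fun i => a + R * c i, fun i => R * r i, fun z => f ((z - a) / R),
    ⟨fun i => mul_pos hR (hF.pos i), ?_, ?_, fun z hz hzU => ?_, fun z hz hzU => ?_⟩, ?_⟩
  · obtain ⟨i, hi⟩ := hF.center_mem
    refine ⟨i, (hD _).2 ?_⟩
    rwa [add_sub_cancel_left, mul_div_cancel_left₀ _ hRC]
  · intro δ hδ
    obtain ⟨V, hV, hSV, g, hg, hfg⟩ := hF.limit δ hδ
    refine ⟨(fun z => (z - a) / R) ⁻¹' V, hV.preimage (by fun_prop),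
      fun z hz => hSV (fun h => hz ((hU z).2 h)), fun z => g ((z - a) / R), ?_,
      fun z hz => hfg _ fun h => hz ((hU z).2 h)⟩
    exact hg.comp (by fun_prop) fun z hz => hz
  · exact hF.ne_zero _ ((hD z).1 hz) fun h => hzU ((hU z).2 h)
  · exact hF.eq_zero _ (fun h => hz ((hD z).2 h)) fun h => hzU ((hU z).2 h)
  · simp_rw [ENNReal.ofReal_mul hR.le]
    rw [ENNReal.tsum_mul_left]
    refine (mul_le_mul_right hsum _).trans ?_
    rw [← ENNReal.ofReal_mul hR.le, mul_div_cancel₀ _ hR.ne']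

/-! ### Cutoff functions, and Green's formula against conjugation. -/

section Bumps

/-- A smooth bump function on `ℂ`, equal to `1` on the unit disc and supported in the disc of
radius `2`. -/
noncomputable def unitBump : ContDiffBump (0 : ℂ) := ⟨1, 2, one_pos, one_lt_two⟩

/-- The bump function `unitBump` rescaled to the disc with centre `c` and radius `r`. -/
noncomputable def scaledBump (c : ℂ) (r : ℝ) (z : ℂ) : ℝ := unitBump (r⁻¹ • (z - c))

variable {c z : ℂ} {r : ℝ}

theorem contDiff_scaledBump : ContDiff ℝ 1 (scaledBump c r) :=
  unitBump.contDiff.comp (by fun_prop)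

theorem scaledBump_nonneg : 0 ≤ scaledBump c r z := unitBump.nonneg

theorem scaledBump_le_one : scaledBump c r z ≤ 1 := unitBump.le_one

theorem scaledBump_eq_one (hr : 0 < r) (hz : z ∈ Metric.ball c r) : scaledBump c r z = 1 := by
  refine unitBump.one_of_mem_closedBall ?_
  rw [mem_closedBall_zero_iff, norm_smul, norm_inv, Real.norm_of_nonneg hr.le,
    inv_mul_le_iff₀ hr, mul_comm]
  rw [Metric.mem_ball, dist_eq_norm] at hz
  change _ ≤ (1 : ℝ) * r
  linarith

theorem scaledBump_eq_zero (hr : 0 < r) (hz : z ∉ Metric.closedBall c (2 * r)) :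
    scaledBump c r z = 0 := by
  refine unitBump.zero_of_le_dist ?_
  rw [dist_zero_right, norm_smul, norm_inv, Real.norm_of_nonneg hr.le, le_inv_mul_iff₀ hr, mul_comm]
  rw [Metric.mem_closedBall, dist_eq_norm, not_le] at hz
  exact hz.le

theorem hasCompactSupport_scaledBump (hr : 0 < r) : HasCompactSupport (scaledBump c r) :=
  HasCompactSupport.intro (isCompact_closedBall c (2 * r)) fun _ hz => scaledBump_eq_zero hr hz

theorem integrable_scaledBump (hr : 0 < r) : Integrable (scaledBump c r) :=
  contDiff_scaledBump.continuous.integrable_of_hasCompactSupport (hasCompactSupport_scaledBump hr)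

theorem integral_comp_inv_smul_sub (f : ℂ → ℝ) (hr : 0 < r) :
    ∫ z, f (r⁻¹ • (z - c)) = r ^ 2 * ∫ z, f z := by
  rw [integral_sub_right_eq_self (fun z => f (r⁻¹ • z)) c,
    Measure.integral_comp_inv_smul_of_nonneg volume f hr.le, Complex.finrank_real_complex,
    smul_eq_mul]

theorem integral_scaledBump (hr : 0 < r) :
    ∫ z, scaledBump c r z = r ^ 2 * ∫ z, unitBump z :=
  integral_comp_inv_smul_sub _ hr

theorem norm_fderiv_scaledBump (hr : 0 < r) :
    ‖fderiv ℝ (scaledBump c r) z‖ = r⁻¹ * ‖fderiv ℝ unitBump (r⁻¹ • (z - c))‖ := by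
  have h1 : HasFDerivAt (fun z : ℂ => r⁻¹ • (z - c)) (r⁻¹ • ContinuousLinearMap.id ℝ ℂ) z :=
    ((hasFDerivAt_id z).sub_const c).const_smul r⁻¹
  have h2 : HasFDerivAt unitBump (fderiv ℝ unitBump (r⁻¹ • (z - c))) (r⁻¹ • (z - c)) :=
    ((unitBump.contDiff (n := 1)).differentiable one_ne_zero _).hasFDerivAt
  have h3 := (h2.comp z h1).fderiv
  change fderiv ℝ (scaledBump c r) z = _ at h3
  rw [h3, ContinuousLinearMap.comp_smul, ContinuousLinearMap.comp_id, norm_smul, norm_inv,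
    Real.norm_of_nonneg hr.le]

/-- The gradient has mass proportional to `r`, whereas the bump itself has mass proportional to `r ^
2`. This is why a bound on the sum of the radii suffices. -/
theorem integral_norm_fderiv_scaledBump (hr : 0 < r) :
    ∫ z, ‖fderiv ℝ (scaledBump c r) z‖ = r * ∫ z, ‖fderiv ℝ unitBump z‖ := by
  simp_rw [norm_fderiv_scaledBump hr]
  rw [integral_const_mul, integral_comp_inv_smul_sub (fun z => ‖fderiv ℝ unitBump z‖) hr]
  field_simp

theorem integrable_norm_fderiv_of_compactSupport {f : ℂ → ℝ} (hf : ContDiff ℝ 1 f)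
    (hc : HasCompactSupport f) : Integrable fun z => ‖fderiv ℝ f z‖ :=
  ((hf.continuous_fderiv one_ne_zero).integrable_of_hasCompactSupport (hc.fderiv ℝ)).norm

end Bumps

section Cutoff

variable {ι : Type} (c : ℂ) (s : ℝ) (a : ι → ℂ) (r : ι → ℝ)

/-- A smooth cutoff function supported in the disc with centre `c` and radius `2 * s`, and vanishing
on the discs with centre `a i` and radius `r i`, `i ∈ S`. -/
noncomputable def cheeseCutoff (S : Finset ι) (z : ℂ) : ℝ :=
  scaledBump c s z * ∏ i ∈ S, (1 - scaledBump (a i) (r i) z)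

theorem cheeseCutoff_insert [DecidableEq ι] {S : Finset ι} {i : ι} (hi : i ∉ S) :
    cheeseCutoff c s a r (insert i S) =
      fun z => (1 - scaledBump (a i) (r i) z) * cheeseCutoff c s a r S z := by
  ext z
  rw [cheeseCutoff, Finset.prod_insert hi, cheeseCutoff]
  ring

theorem contDiff_cheeseCutoff (S : Finset ι) : ContDiff ℝ 1 (cheeseCutoff c s a r S) :=
  contDiff_scaledBump.mul (contDiff_prod fun _ _ => contDiff_const.sub contDiff_scaledBump)

theorem hasCompactSupport_cheeseCutoff (hs : 0 < s) (S : Finset ι) :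
    HasCompactSupport (cheeseCutoff c s a r S) :=
  (hasCompactSupport_scaledBump hs).mul_right

theorem cheeseCutoff_nonneg (S : Finset ι) (z : ℂ) : 0 ≤ cheeseCutoff c s a r S z :=
  mul_nonneg scaledBump_nonneg (Finset.prod_nonneg fun _ _ => sub_nonneg.2 scaledBump_le_one)

theorem cheeseCutoff_le_one (S : Finset ι) (z : ℂ) : cheeseCutoff c s a r S z ≤ 1 :=
  mul_le_one₀ scaledBump_le_one
    (Finset.prod_nonneg fun _ _ => sub_nonneg.2 scaledBump_le_one)
    (Finset.prod_le_one (fun _ _ => sub_nonneg.2 scaledBump_le_one)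
      fun _ _ => sub_le_self _ scaledBump_nonneg)

theorem le_cheeseCutoff (S : Finset ι) (z : ℂ) :
    scaledBump c s z - ∑ i ∈ S, scaledBump (a i) (r i) z ≤ cheeseCutoff c s a r S z := by
  classical
  induction S using Finset.induction with
  | empty => simp [cheeseCutoff]
  | insert i S hi ih =>
    rw [cheeseCutoff_insert c s a r hi, Finset.sum_insert hi]
    have h1 := cheeseCutoff_le_one c s a r S z
    have h2 : 0 ≤ scaledBump (a i) (r i) z := scaledBump_nonneg
    nlinarith

theorem norm_fderiv_cheeseCutoff_le (S : Finset ι) (z : ℂ) :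
    ‖fderiv ℝ (cheeseCutoff c s a r S) z‖ ≤ ‖fderiv ℝ (scaledBump c s) z‖ +
      ∑ i ∈ S, ‖fderiv ℝ (scaledBump (a i) (r i)) z‖ := by
  classical
  induction S using Finset.induction with
  | empty =>
    have : cheeseCutoff c s a r ∅ = scaledBump c s := by
      ext z
      simp [cheeseCutoff]
    rw [this, Finset.sum_empty, add_zero]
  | insert i S hi ih =>
    have hb : DifferentiableAt ℝ (scaledBump (a i) (r i)) z :=
      contDiff_scaledBump.differentiable one_ne_zero z
    have hp : DifferentiableAt ℝ (cheeseCutoff c s a r S) z :=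
      (contDiff_cheeseCutoff c s a r S).differentiable one_ne_zero z
    rw [cheeseCutoff_insert c s a r hi, Finset.sum_insert hi,
      fderiv_fun_mul (hb.const_sub 1) hp, fderiv_const_sub]
    refine (norm_add_le _ _).trans ?_
    rw [norm_smul, norm_smul, norm_neg,
      Real.norm_of_nonneg (sub_nonneg.2 (scaledBump_le_one (c := a i) (r := r i) (z := z))),
      Real.norm_of_nonneg (cheeseCutoff_nonneg c s a r S z)]
    have h1 := cheeseCutoff_le_one c s a r S z
    have h2 : 0 ≤ scaledBump (a i) (r i) z := scaledBump_nonneg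
    have h3 := norm_nonneg (fderiv ℝ (cheeseCutoff c s a r S) z)
    have h4 := norm_nonneg (fderiv ℝ (scaledBump (a i) (r i)) z)
    nlinarith

variable {c s a r}

theorem cheeseCutoff_eventuallyEq_zero (hs : 0 < s) (hr : ∀ i, 0 < r i) {S : Finset ι} {z : ℂ}
    (hz : z ∈ Metric.closedBall c (2 * s) → ∃ i ∈ S, z ∈ Metric.ball (a i) (r i)) :
    cheeseCutoff c s a r S =ᶠ[𝓝 z] 0 := by
  by_cases hzc : z ∈ Metric.closedBall c (2 * s)
  · obtain ⟨i, hi, hzi⟩ := hz hzc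
    filter_upwards [Metric.isOpen_ball.mem_nhds hzi] with w hw
    rw [cheeseCutoff, Finset.prod_eq_zero hi, mul_zero, Pi.zero_apply]
    rw [scaledBump_eq_one (hr i) hw, sub_self]
  · filter_upwards [Metric.isClosed_closedBall.isOpen_compl.mem_nhds hzc] with w hw
    rw [cheeseCutoff, scaledBump_eq_zero hs hw, zero_mul, Pi.zero_apply]

theorem le_integral_cheeseCutoff (hs : 0 < s) (hr : ∀ i, 0 < r i) {S : Finset ι}
    (hsum : ∑ i ∈ S, r i ≤ s / 2) :
    s ^ 2 * (3 / 4) * ∫ z, unitBump z ≤ ∫ z, cheeseCutoff c s a r S z := by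
  have hint : Integrable (fun z => ∑ i ∈ S, scaledBump (a i) (r i) z) :=
    integrable_finsetSum _ fun i _ => integrable_scaledBump (hr i)
  have h1 : ∫ z, (scaledBump c s z - ∑ i ∈ S, scaledBump (a i) (r i) z)
      ≤ ∫ z, cheeseCutoff c s a r S z :=
    integral_mono ((integrable_scaledBump hs).sub hint)
      ((contDiff_cheeseCutoff c s a r S).continuous.integrable_of_hasCompactSupport
        (hasCompactSupport_cheeseCutoff c s a r hs S)) (le_cheeseCutoff c s a r S)
  rw [integral_sub (integrable_scaledBump hs) hint,
    integral_finsetSum _ fun i _ => integrable_scaledBump (hr i), integral_scaledBump hs] at h1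
  simp_rw [fun i => integral_scaledBump (c := a i) (hr i)] at h1
  rw [← Finset.sum_mul] at h1
  refine le_trans ?_ h1
  rw [← sub_mul]
  refine mul_le_mul_of_nonneg_right ?_ (integral_nonneg fun _ => unitBump.nonneg)
  -- The squares sum to at most `(s / 2) ^ 2`, so the removed bumps cost at most a quarter of the
  -- mass.
  have h2 : ∑ i ∈ S, r i ^ 2 ≤ ∑ i ∈ S, r i * (s / 2) := by
    refine Finset.sum_le_sum fun i hi => ?_
    have : r i ≤ ∑ i ∈ S, r i := Finset.single_le_sum (fun j _ => (hr j).le) hi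
    nlinarith [hr i]
  rw [← Finset.sum_mul] at h2
  nlinarith

theorem integral_norm_fderiv_cheeseCutoff_le (hs : 0 < s) (hr : ∀ i, 0 < r i) {S : Finset ι}
    (hsum : ∑ i ∈ S, r i ≤ s / 2) :
    ∫ z, ‖fderiv ℝ (cheeseCutoff c s a r S) z‖ ≤ 2 * s * ∫ z, ‖fderiv ℝ unitBump z‖ := by
  have hi : ∀ (c : ℂ) (s : ℝ), 0 < s → Integrable fun z => ‖fderiv ℝ (scaledBump c s) z‖ :=
    fun c s hs => integrable_norm_fderiv_of_compactSupport contDiff_scaledBump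
      (hasCompactSupport_scaledBump hs)
  have hint : Integrable (fun z => ∑ i ∈ S, ‖fderiv ℝ (scaledBump (a i) (r i)) z‖) :=
    integrable_finsetSum _ fun i _ => hi _ _ (hr i)
  have h1 := integral_mono (integrable_norm_fderiv_of_compactSupport
    (contDiff_cheeseCutoff c s a r S) (hasCompactSupport_cheeseCutoff c s a r hs S))
    ((hi c s hs).add hint) (norm_fderiv_cheeseCutoff_le c s a r S)
  simp only [Pi.add_apply] at h1
  rw [integral_add (hi c s hs) hint, integral_finsetSum _ fun i _ => hi _ _ (hr i),
    integral_norm_fderiv_scaledBump hs] at h1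
  simp_rw [fun i => integral_norm_fderiv_scaledBump (c := a i) (hr i)] at h1
  rw [← Finset.sum_mul, ← add_mul] at h1
  exact h1.trans (mul_le_mul_of_nonneg_right (by linarith)
    (integral_nonneg fun _ => norm_nonneg _))

end Cutoff

theorem integral_fderiv_apply_eq_zero {F : ℂ → ℂ} (hF : ContDiff ℝ 1 F) (hc : HasCompactSupport F)
    (v : ℂ) : Integrable (fun z => fderiv ℝ F z v) ∧ ∫ z, fderiv ℝ F z v = 0 := by
  have hint : Integrable (fun z => fderiv ℝ F z v) :=
    ((hF.continuous_fderiv one_ne_zero).clm_apply continuous_const).integrable_of_hasCompactSupport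
      (hc.fderiv_apply ℝ v)
  refine ⟨hint, ?_⟩
  have h := integral_mul_fderiv_eq_neg_fderiv_mul_of_integrable (μ := (volume : Measure ℂ))
    (f := fun _ : ℂ => (1 : ℂ)) (g := F) (v := v) (by simp) (by simpa using hint)
    (by simpa using hF.continuous.integrable_of_hasCompactSupport hc)
    (fun x _ => differentiableAt_const _) (fun x _ => hF.differentiable one_ne_zero x)
  simpa using h

/-- The derivative `∂/∂x + i ∂/∂y` of a product of a real cutoff function with `g - conj`, where `g`
is holomorphic. -/
theorem fderiv_cutoff_mul_sub_conj {P : ℂ → ℝ} {g : ℂ → ℂ} {z : ℂ}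
    (hP : DifferentiableAt ℝ P z) (hg : DifferentiableAt ℂ g z) :
    fderiv ℝ (fun w => (P w : ℂ) * (g w - starRingEnd ℂ w)) z 1 +
      Complex.I * fderiv ℝ (fun w => (P w : ℂ) * (g w - starRingEnd ℂ w)) z Complex.I =
    -(2 * P z : ℝ) + (g z - starRingEnd ℂ z) *
      ((fderiv ℝ P z 1 : ℝ) + Complex.I * (fderiv ℝ P z Complex.I : ℝ)) := by
  have h1 : HasFDerivAt (fun w => (P w : ℂ)) (Complex.ofRealCLM.comp (fderiv ℝ P z)) z :=
    Complex.ofRealCLM.hasFDerivAt.comp z hP.hasFDerivAt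
  have h2 : HasFDerivAt (fun w => g w - starRingEnd ℂ w)
      ((fderiv ℂ g z).restrictScalars ℝ - (Complex.conjCLE : ℂ →L[ℝ] ℂ)) z :=
    (hg.hasFDerivAt.restrictScalars ℝ).sub Complex.conjCLE.hasFDerivAt
  rw [(h1.fun_mul h2).fderiv]
  have h3 : fderiv ℂ g z Complex.I = Complex.I * fderiv ℂ g z 1 := by
    rw [← smul_eq_mul, ← map_smul, smul_eq_mul, mul_one]
  simp [h3]
  linear_combination (P z * (deriv g z + 1) : ℂ) * Complex.I_mul_I

/-- Suppose a holomorphic `g` is within `δ` of conjugation, and let `P` be a cutoff vanishing on the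
discs that matter. The integral of `∂/∂x + i ∂/∂y` of `P * (g - conj)` is 0, which gives `∫ P ≤ δ *
∫ ‖fderiv ℝ P‖`. The left side is at least a multiple of `s ^ 2` and the right side at most a
multiple of `δ * s`. -/
theorem not_isHolomorphicLimit_conj {ι : Type} {c : ℂ} {s : ℝ} {a : ι → ℂ} {r : ι → ℝ} (hs : 0 < s)
    (hr : ∀ i, 0 < r i) (hsum : ∑' i, ENNReal.ofReal (r i) ≤ ENNReal.ofReal (s / 2)) :
    ¬ IsHolomorphicLimit (Metric.closedBall c (2 * s) \ ⋃ i, Metric.ball (a i) (r i))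
      (starRingEnd ℂ) := by
  intro hlim
  set J := ∫ z, unitBump z with hJ
  set L := ∫ z, ‖fderiv ℝ unitBump z‖ with hL
  have hJ0 : 0 < J := unitBump.integral_pos
  have hL0 : 0 ≤ L := integral_nonneg fun _ => norm_nonneg _
  -- With this `δ` the upper bound for `2 * ∫ P` is at most `s ^ 2 * J / 2`, below the lower bound
  -- `3 / 2 * s ^ 2 * J`. The `+ 1` keeps the denominator positive.
  obtain ⟨V, hV, hKV, g, hg, hgδ⟩ := hlim (s * J / (8 * (L + 1))) (by positivity)
  set δ := s * J / (8 * (L + 1)) with hδ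
  have hδ0 : 0 < δ := by positivity
  set W := V ∩ {z | ‖starRingEnd ℂ z - g z‖ < δ} with hW
  have hWo : IsOpen W :=
    (((Complex.continuous_conj.continuousOn).sub hg.continuousOn).norm).isOpen_inter_preimage hV
      isOpen_Iio
  -- Compactness leaves finitely many discs covering the part of the large disc outside `W`; the
  -- cutoff then vanishes near every point where `g` is not under control.
  have hcov : Metric.closedBall c (2 * s) \ W ⊆ ⋃ i, Metric.ball (a i) (r i) := by
    intro z hz
    by_contra hzU
    exact hz.2 ⟨hKV ⟨hz.1, hzU⟩, hgδ z ⟨hz.1, hzU⟩⟩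
  obtain ⟨S, hS⟩ := ((isCompact_closedBall c (2 * s)).diff hWo).elim_finite_subcover _
    (fun i => Metric.isOpen_ball) hcov
  have hSsum : ∑ i ∈ S, r i ≤ s / 2 := by
    rw [← ENNReal.ofReal_le_ofReal_iff (by positivity),
      ENNReal.ofReal_sum_of_nonneg fun i _ => (hr i).le]
    exact (ENNReal.sum_le_tsum S).trans hsum
  set P := cheeseCutoff c s a r S with hP
  have hPd : ContDiff ℝ 1 P := contDiff_cheeseCutoff c s a r S
  have hPc : HasCompactSupport P := hasCompactSupport_cheeseCutoff c s a r hs S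
  have hP0 : ∀ z, z ∉ W → P =ᶠ[𝓝 z] 0 := fun z hz =>
    cheeseCutoff_eventuallyEq_zero hs hr fun hzc => by
      simpa using hS ⟨hzc, hz⟩
  set F : ℂ → ℂ := fun w => (P w : ℂ) * (g w - starRingEnd ℂ w) with hF
  have hF0 : ∀ z, z ∉ W → F =ᶠ[𝓝 z] 0 := fun z hz => by
    filter_upwards [hP0 z hz] with w hw
    simp [hF, hw]
  have hFd : ContDiff ℝ 1 F := by
    rw [contDiff_iff_contDiffAt]
    intro z
    by_cases hz : z ∈ W
    · have h1 : ContDiffAt ℝ 1 g z :=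
        ((hg.analyticAt (hV.mem_nhds hz.1)).contDiffAt (n := 1)).restrict_scalars ℝ
      exact (Complex.ofRealCLM.contDiff.comp hPd).contDiffAt.mul
        (h1.sub Complex.conjCLE.contDiff.contDiffAt)
    · exact contDiffAt_const.congr_of_eventuallyEq (hF0 z hz)
  have hFc : HasCompactSupport F := (hPc.comp_left Complex.ofReal_zero).mul_right
  obtain ⟨hi1, h1⟩ := integral_fderiv_apply_eq_zero hFd hFc 1
  obtain ⟨hi2, h2⟩ := integral_fderiv_apply_eq_zero hFd hFc Complex.I
  have hiP : Integrable (fun z => ((2 * P z : ℝ) : ℂ)) :=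
    ((hPd.continuous.integrable_of_hasCompactSupport hPc).const_mul 2).ofReal
  have hpt : ∀ z, ‖((2 * P z : ℝ) : ℂ) + (fderiv ℝ F z 1 + Complex.I * fderiv ℝ F z Complex.I)‖
      ≤ 2 * δ * ‖fderiv ℝ P z‖ := by
    intro z
    by_cases hz : z ∈ W
    · rw [fderiv_cutoff_mul_sub_conj (hPd.differentiable one_ne_zero z)
        (hg.differentiableAt (hV.mem_nhds hz.1)), add_neg_cancel_left, norm_mul, norm_sub_rev]
      have h3 := (fderiv ℝ P z).le_opNorm 1
      have h4 := (fderiv ℝ P z).le_opNorm Complex.I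
      rw [norm_one, mul_one] at h3
      rw [Complex.norm_I, mul_one] at h4
      have h5 : ‖((fderiv ℝ P z 1 : ℝ) : ℂ) + Complex.I * (fderiv ℝ P z Complex.I : ℝ)‖
          ≤ 2 * ‖fderiv ℝ P z‖ := by
        refine (norm_add_le _ _).trans ?_
        rw [norm_mul, Complex.norm_I, one_mul, Complex.norm_real, Complex.norm_real]
        linarith
      calc _ ≤ δ * (2 * ‖fderiv ℝ P z‖) := mul_le_mul hz.2.le h5 (norm_nonneg _) hδ0.le
        _ = _ := by ring
    · rw [(hF0 z hz).fderiv_eq, (hP0 z hz).fderiv_eq, (hP0 z hz).eq_of_nhds]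
      simp
  have h3 : ∫ z, (((2 * P z : ℝ) : ℂ) + (fderiv ℝ F z 1 + Complex.I * fderiv ℝ F z Complex.I))
      = ((2 * ∫ z, P z : ℝ) : ℂ) := by
    have hi3 : Integrable fun z => fderiv ℝ F z 1 + Complex.I * fderiv ℝ F z Complex.I :=
      hi1.add (hi2.const_mul _)
    rw [integral_add hiP hi3, integral_add hi1 (hi2.const_mul _),
      integral_const_mul, h1, h2, mul_zero, add_zero, add_zero, ← integral_const_mul]
    exact integral_complex_ofReal
  have h4 := norm_integral_le_of_norm_le
    ((integrable_norm_fderiv_of_compactSupport hPd hPc).const_mul (2 * δ))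
    (Eventually.of_forall hpt)
  rw [h3, integral_const_mul, Complex.norm_real] at h4
  have h5 := le_integral_cheeseCutoff (c := c) (a := a) hs hr hSsum
  have h6 := integral_norm_fderiv_cheeseCutoff_le (c := c) (a := a) hs hr hSsum
  rw [← hP, ← hJ] at h5
  rw [← hP, ← hL] at h6
  have h7 : 2 * ∫ z, P z ≤ 2 * δ * (2 * s * L) :=
    (le_abs_self _).trans (h4.trans (mul_le_mul_of_nonneg_left h6 (by positivity)))
  have h8 : δ * L ≤ s * J / 8 := by
    rw [hδ, div_mul_eq_mul_div, div_le_div_iff₀ (by positivity) (by norm_num)]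
    nlinarith [mul_pos hs hJ0]
  have h9 : 0 < s * (s * J) := by positivity
  have h10 : s * (δ * L) ≤ s * (s * J / 8) := mul_le_mul_of_nonneg_left h8 hs.le
  nlinarith

/-! ### Swiss cheeses and their algebras. -/

theorem IsHolomorphicLimit.mono {S T : Set ℂ} {f : ℂ → ℂ} (hf : IsHolomorphicLimit T f)
    (h : S ⊆ T) : IsHolomorphicLimit S f := fun δ hδ => by
  obtain ⟨V, hV, hTV, g, hg, hfg⟩ := hf δ hδ
  exact ⟨V, hV, h.trans hTV, g, hg, fun z hz => hfg z (h hz)⟩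

theorem IsHolomorphicLimit.continuousOn {S : Set ℂ} {f : ℂ → ℂ} (hf : IsHolomorphicLimit S f) :
    ContinuousOn f S := by
  refine continuousOn_of_uniform_approx_of_continuousOn fun u hu => ?_
  obtain ⟨δ, hδ, hδu⟩ := Metric.mem_uniformity_dist.1 hu
  obtain ⟨V, -, hSV, g, hg, hfg⟩ := hf δ hδ
  refine ⟨g, hg.continuousOn.mono hSV, fun z hz => hδu ?_⟩
  rw [dist_eq_norm]
  exact hfg z hz

section UniformHolomorphic

variable {Y : Type*} [TopologicalSpace Y] [CompactSpace Y] {j : C(Y, ℂ)}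

theorem mem_uniformHolomorphic_iff {f : ℂ → ℂ} {F : C(Y, ℂ)} (hF : ∀ y, F y = f (j y)) :
    F ∈ uniformHolomorphic j ↔ IsHolomorphicLimit (Set.range j) f := by
  change F ∈ closure (holomorphicTrace j : Set C(Y, ℂ)) ↔ _
  rw [Metric.mem_closure_iff]
  constructor
  · intro h δ hδ
    obtain ⟨G, ⟨U, hU, hjU, g, hg, hGg⟩, hFG⟩ := h δ hδ
    refine ⟨U, hU, Set.range_subset_iff.2 hjU, g, hg, ?_⟩
    rintro _ ⟨y, rfl⟩
    rw [← hF, ← hGg, ← dist_eq_norm]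
    exact (ContinuousMap.dist_apply_le_dist y).trans_lt hFG
  · intro h δ hδ
    obtain ⟨V, hV, hjV, g, hg, hfg⟩ := h (δ / 2) (half_pos hδ)
    have hjV' : ∀ y, j y ∈ V := Set.range_subset_iff.1 hjV
    refine ⟨⟨fun y => g (j y), hg.continuousOn.comp_continuous j.continuous hjV'⟩,
      ⟨V, hV, hjV', g, hg, fun _ => rfl⟩, ?_⟩
    refine lt_of_le_of_lt ((ContinuousMap.dist_le (half_pos hδ).le).2 fun y => ?_) (half_lt_self hδ)
    rw [hF, dist_eq_norm]
    exact (hfg _ ⟨y, rfl⟩).le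

end UniformHolomorphic

/-- A nowhere dense compact set on which the uniform limits of functions holomorphic near the set
form a regular and proper algebra. -/
structure IsSwissCheese (K : Set ℂ) : Prop where
  isCompact : IsCompact K
  interior_eq_empty : interior K = ∅
  regular : ∀ x ∈ K, ∀ W : Set ℂ, IsOpen W → x ∈ W →
    ∃ f : ℂ → ℂ, IsHolomorphicLimit K f ∧ f x ≠ 0 ∧ ∀ z ∈ K, z ∉ W → f z = 0
  conj_not_limit : ¬ IsHolomorphicLimit K (starRingEnd ℂ)

namespace IsSwissCheese

variable {Y : Type*} [TopologicalSpace Y] [CompactSpace Y] {j : C(Y, ℂ)}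

theorem uniformHolomorphic_ne_top (hK : IsSwissCheese (Set.range j)) :
    uniformHolomorphic j ≠ ⊤ := by
  intro h
  let F : C(Y, ℂ) := ⟨fun y => starRingEnd ℂ (j y), by fun_prop⟩
  have hF : F ∈ uniformHolomorphic j := by
    rw [h]
    trivial
  exact hK.conj_not_limit ((mem_uniformHolomorphic_iff (F := F) fun _ => rfl).1 hF)

theorem isRegularOnSpace_uniformHolomorphic (hK : IsSwissCheese (Set.range j))
    (hj : Function.Injective j) : IsRegularOnSpace (uniformHolomorphic j) := by
  intro E hE x hx
  have hW : IsOpen (j '' E)ᶜ := (hE.isCompact.image j.continuous).isClosed.isOpen_compl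
  have hxW : j x ∈ (j '' E)ᶜ := fun ⟨y, hy, hyx⟩ => hx (hj hyx ▸ hy)
  obtain ⟨f, hf, hfx, hf0⟩ := hK.regular (j x) ⟨x, rfl⟩ _ hW hxW
  let F : C(Y, ℂ) := ⟨fun y => f (j y),
    hf.continuousOn.comp_continuous j.continuous fun y => ⟨y, rfl⟩⟩
  have hF : F ∈ uniformHolomorphic j := (mem_uniformHolomorphic_iff fun _ => rfl).2 hf
  refine ⟨(f (j x))⁻¹ • F, Subalgebra.smul_mem _ hF _, inv_mul_cancel₀ hfx, fun y hy => ?_⟩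
  rw [ContinuousMap.smul_apply, smul_eq_mul,
    show F y = 0 from hf0 _ ⟨y, rfl⟩ fun h => h ⟨y, hy, rfl⟩, mul_zero]

end IsSwissCheese

theorem exists_seq_balls_basis : ∃ (a : ℕ → ℂ) (R : ℕ → ℝ), (∀ m, 0 < R m) ∧
    ∀ x, ∀ W : Set ℂ, IsOpen W → x ∈ W →
      ∃ m, x ∈ Metric.ball (a m) (R m) ∧ Metric.ball (a m) (R m) ⊆ W := by
  refine ⟨fun m => TopologicalSpace.denseSeq ℂ m.unpair.1, fun m => 1 / (m.unpair.2 + 1),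
    fun m => Nat.one_div_pos_of_nat, fun x W hW hx => ?_⟩
  obtain ⟨t, ht, htW⟩ := Metric.isOpen_iff.1 hW x hx
  obtain ⟨n, hn⟩ := exists_nat_one_div_lt (half_pos ht)
  have hn0 : (0 : ℝ) < 1 / (n + 1) := Nat.one_div_pos_of_nat
  obtain ⟨k, hk⟩ := (TopologicalSpace.denseRange_denseSeq ℂ).exists_dist_lt x hn0
  refine ⟨Nat.pair k n, ?_, fun z hz => htW ?_⟩
  · simpa using hk
  · simp only [Nat.unpair_pair, Metric.mem_ball] at hz ⊢
    rw [dist_comm] at hk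
    linarith [dist_triangle z (TopologicalSpace.denseSeq ℂ k) x]

/-- Discs are removed for every ball of a countable base, with total radius at most `s / 2`. Each
basic ball contains the centre of a removed disc, so no interior remains. -/
theorem exists_isSwissCheese (c : ℂ) {s : ℝ} (hs : 0 < s) :
    ∃ K ⊆ Metric.closedBall c (2 * s), IsSwissCheese K := by
  obtain ⟨a, R, hR, hbasis⟩ := exists_seq_balls_basis
  choose ι b r f hF hsum using fun m =>
    exists_cheeseFamily (a m) (hR m) (show 0 < s / 4 * (1 / 2) ^ m by positivity)
  have hsub : ∀ m, ⋃ i, Metric.ball (b m i) (r m i) ⊆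
      ⋃ i : Σ m, ι m, Metric.ball (b i.1 i.2) (r i.1 i.2) := fun m =>
    Set.iUnion_subset fun i => Set.subset_iUnion_of_subset ⟨m, i⟩ subset_rfl
  refine ⟨Metric.closedBall c (2 * s) \ ⋃ i : Σ m, ι m, Metric.ball (b i.1 i.2) (r i.1 i.2),
    Set.sdiff_subset, (isCompact_closedBall _ _).diff (isOpen_iUnion fun _ => Metric.isOpen_ball),
    ?_, fun x hx W hW hxW => ?_, not_isHolomorphicLimit_conj hs (fun i => (hF i.1).pos i.2) ?_⟩
  · rw [Set.eq_empty_iff_forall_notMem]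
    intro x hx
    obtain ⟨m, -, hm⟩ := hbasis x _ isOpen_interior hx
    obtain ⟨i, hi⟩ := (hF m).center_mem
    exact (interior_subset (hm hi)).2
      (hsub m (Set.mem_iUnion.2 ⟨i, Metric.mem_ball_self ((hF m).pos i)⟩))
  · obtain ⟨m, hxm, hm⟩ := hbasis x W hW hxW
    refine ⟨f m, (hF m).limit.mono fun z hz h => hz.2 (hsub m h),
      (hF m).ne_zero x hxm fun h => hx.2 (hsub m h),
      fun z hz hzW => (hF m).eq_zero z (fun h => hzW (hm h)) fun h => hz.2 (hsub m h)⟩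
  · rw [ENNReal.tsum_sigma']
    refine (ENNReal.tsum_le_tsum hsum).trans ?_
    rw [← ENNReal.ofReal_tsum_of_nonneg (fun n => by positivity)
      (summable_geometric_two.mul_left _), tsum_mul_left, tsum_geometric_two]
    exact ENNReal.ofReal_le_ofReal (by linarith)

theorem exists_isSwissCheese_subset_disjoint {U C : Set ℂ} (hU : IsOpen U) (hne : U.Nonempty)
    (hC : IsClosed C) (hC0 : interior C = ∅) {ε : ℝ} (hε : 0 < ε) :
    ∃ K ⊆ U, IsSwissCheese K ∧ Disjoint C K ∧ Metric.diam K ≤ ε := by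
  have hUC : (U \ C).Nonempty := by
    rw [Set.nonempty_iff_ne_empty]
    intro h
    obtain ⟨x, hx⟩ := hne
    have := interior_maximal (Set.sdiff_eq_empty.1 h) hU hx
    rwa [hC0] at this
  obtain ⟨z, hz⟩ := hUC
  obtain ⟨t, ht, htU⟩ := Metric.isOpen_iff.1 (hU.sdiff hC) z hz
  have hs : 0 < min (t / 4) (ε / 4) := by positivity
  obtain ⟨K, hKs, hK⟩ := exists_isSwissCheese z hs
  have hKU : K ⊆ U \ C := hKs.trans ((Metric.closedBall_subset_ball (by
    linarith [min_le_left (t / 4) (ε / 4)])).trans htU)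
  refine ⟨K, fun x hx => (hKU hx).1, hK, Set.disjoint_left.2 fun x hxC hx => (hKU hx).2 hxC, ?_⟩
  calc Metric.diam K ≤ Metric.diam (Metric.closedBall z (2 * min (t / 4) (ε / 4))) :=
        Metric.diam_mono hKs Metric.isBounded_closedBall
    _ ≤ 2 * (2 * min (t / 4) (ε / 4)) := Metric.diam_closedBall (by positivity)
    _ ≤ ε := by linarith [min_le_right (t / 4) (ε / 4)]

/-- Finitely many cheeses form a closed set without interior, so every basic ball still has room for
a new one disjoint from them. -/
theorem exists_seq_isSwissCheese {D : Set ℂ} (hD : IsOpen D) (hDne : D.Nonempty) :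
    ∃ K : ℕ → Set ℂ, (∀ n, IsSwissCheese (K n)) ∧
    (∀ n, K n ⊆ D) ∧ Pairwise (Function.onFun Disjoint K) ∧
    (∀ n, Metric.diam (K n) ≤ 1 / (n + 1)) ∧
    ∀ U : Set ℂ, IsOpen U → (U ∩ D).Nonempty → ∃ n, K n ⊆ U := by
  obtain ⟨a, R, hR, hbasis⟩ := exists_seq_balls_basis
  have step : ∀ (n : ℕ) (C : {C : Set ℂ // IsClosed C ∧ interior C = ∅}), ∃ K ⊆ D,
      IsSwissCheese K ∧ Disjoint (C : Set ℂ) K ∧ Metric.diam K ≤ 1 / (n + 1) ∧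
      (Metric.ball (a n) (R n) ⊆ D → K ⊆ Metric.ball (a n) (R n)) := by
    intro n C
    have hn : (0 : ℝ) < 1 / (n + 1) := Nat.one_div_pos_of_nat
    by_cases h : Metric.ball (a n) (R n) ⊆ D
    · obtain ⟨K, hKU, hK, hCK, hdiam⟩ := exists_isSwissCheese_subset_disjoint Metric.isOpen_ball
        (Metric.nonempty_ball.2 (hR n)) C.2.1 C.2.2 hn
      exact ⟨K, hKU.trans h, hK, hCK, hdiam, fun _ => hKU⟩
    -- A basic ball not inside `D` imposes no condition; any cheese in `D` fills the index.
    · obtain ⟨K, hKU, hK, hCK, hdiam⟩ := exists_isSwissCheese_subset_disjoint hD hDne C.2.1 C.2.2 hn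
      exact ⟨K, hKU, hK, hCK, hdiam, fun h' => (h h').elim⟩
  choose k hkD hk hkC hkdiam hkball using step
  let C : ℕ → {C : Set ℂ // IsClosed C ∧ interior C = ∅} := fun n => Nat.rec
    ⟨∅, isClosed_empty, interior_empty⟩
    (fun n C => ⟨(C : Set ℂ) ∪ k n C, C.2.1.union (hk n C).isCompact.isClosed, by
      rw [interior_union_isClosed_of_interior_empty C.2.1 (hk n C).interior_eq_empty, C.2.2]⟩) n
  have hCsucc : ∀ n, (C (n + 1)).1 = (C n).1 ∪ k n (C n) := fun n => rfl
  have hCmono : Monotone fun n => (C n).1 := monotone_nat_of_le_succ fun n => by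
    rw [hCsucc]
    exact Set.subset_union_left
  refine ⟨fun n => k n (C n), fun n => hk n _, fun n => hkD n _, ?_, fun n => hkdiam n _,
    fun U hU hUD => ?_⟩
  · have hlt : ∀ m n, m < n → Disjoint (k m (C m)) (k n (C n)) := fun m n hmn => by
      refine (hkC n (C n)).mono_left (le_trans ?_ (hCmono (Nat.succ_le_of_lt hmn)))
      change k m (C m) ⊆ (C (m + 1)).1
      rw [hCsucc]
      exact Set.subset_union_right
    intro m n hmn
    rcases lt_or_gt_of_ne hmn with h | h
    · exact hlt m n h
    · exact (hlt n m h).symm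
  · obtain ⟨x, hxU, hxD⟩ := hUD
    obtain ⟨m, -, hm⟩ := hbasis x (U ∩ D) (hU.inter hD) ⟨hxU, hxD⟩
    exact ⟨m, (hkball m _ (hm.trans Set.inter_subset_right)).trans (hm.trans Set.inter_subset_left)⟩

theorem IsRegularOnSpace.exists_ne {X : Type*} [TopologicalSpace X] [T1Space X]
    {A : Subalgebra ℂ C(X, ℂ)} (hA : IsRegularOnSpace A) (x y : X) (hxy : x ≠ y) :
    ∃ f ∈ A, f x ≠ f y := by
  obtain ⟨f, hf, hfx, hfy⟩ := hA {y} isClosed_singleton x hxy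
  refine ⟨f, hf, ?_⟩
  rw [hfx, hfy y rfl]
  exact one_ne_zero

theorem theorem1p2 :
    ∃ A : Subalgebra ℂ C(Metric.closedBall (0 : ℂ) 1, ℂ),
      IsUniformAlgebra A ∧ IsEssentialAlgebra A ∧ IsNaturalAlgebra A ∧ IsRegularAlgebra A := by
  obtain ⟨K, hK, hKD, hKdisj, hKdiam, hKdense⟩ := exists_seq_isSwissCheese
    (Metric.isOpen_ball (x := (0 : ℂ)) (ε := 1)) (Metric.nonempty_ball.2 one_pos)
  let L : ℕ → Set (Metric.closedBall (0 : ℂ) 1) := fun n => Subtype.val ⁻¹' K n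
  have hLK : ∀ n, Subtype.val '' L n = K n := fun n => by
    rw [Subtype.image_preimage_coe]
    exact Set.inter_eq_right.2 ((hKD n).trans Metric.ball_subset_closedBall)
  have hLcl : ∀ n, IsClosed (L n) := fun n =>
    (hK n).isCompact.isClosed.preimage continuous_subtype_val
  have hLdisj : Pairwise (Function.onFun Disjoint L) := fun m n hmn =>
    (hKdisj hmn).preimage Subtype.val
  have hLdiam : ∀ ε > 0, {n | ε ≤ Metric.diam (L n)}.Finite := by
    intro ε hε
    have h1 := (tendsto_one_div_add_atTop_nhds_zero_nat (𝕜 := ℝ)).eventually_lt_const hε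
    rw [← Nat.cofinite_eq_atTop] at h1
    refine Set.Finite.subset h1 fun n (hn : ε ≤ _) (h : _ < ε) => h.not_ge (hn.trans ?_)
    rw [← isometry_subtype_coe.diam_image, hLK]
    exact hKdiam n
  have hcomp : ∀ n, CompactSpace (L n) := fun n => isCompact_iff_compactSpace.1 (hLcl n).isCompact
  let j : ∀ n, C(L n, ℂ) := fun n => ⟨fun x => ((x : Metric.closedBall (0 : ℂ) 1) : ℂ), by fun_prop⟩
  have hj : ∀ n, Function.Injective (j n) := fun n =>
    Subtype.val_injective.comp Subtype.val_injective
  have hrange : ∀ n, IsSwissCheese (Set.range (j n)) := fun n => by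
    have : Set.range (j n) = K n := by
      rw [← hLK n, Set.image_eq_range]
      rfl
    rw [this]
    exact hK n
  have hLdense : ∀ U : Set (Metric.closedBall (0 : ℂ) 1), IsOpen U → U.Nonempty →
      ∃ n, L n ⊆ U := by
    rintro _ ⟨W, hW, rfl⟩ ⟨x, hx⟩
    -- The cheeses lie in the open disc, whose density handles neighbourhoods of boundary points.
    have hxc : (x : ℂ) ∈ closure (Metric.ball (0 : ℂ) 1) := by
      rw [closure_ball _ one_ne_zero]
      exact x.2
    obtain ⟨n, hn⟩ := hKdense W hW (mem_closure_iff.1 hxc W hW hx)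
    exact ⟨n, Set.preimage_mono hn⟩
  let A : ∀ n, Subalgebra ℂ C(L n, ℂ) := fun n => uniformHolomorphic (j n)
  have hAcl : ∀ n, IsClosed (A n : Set C(L n, ℂ)) := fun n => isClosed_uniformHolomorphic (j n)
  have hnat : IsNaturalAlgebra (gluedAlgebra A) := isNaturalAlgebra_gluedAlgebra hLdisj hLcl hLdiam
    hAcl fun n => isNaturalAlgebra_uniformHolomorphic (j n)
  have hreg : IsRegularOnSpace (gluedAlgebra A) := isRegularOnSpace_gluedAlgebra hLdisj hLcl hLdiam
    fun n => (hrange n).isRegularOnSpace_uniformHolomorphic (hj n)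
  exact ⟨gluedAlgebra A, ⟨isClosed_gluedAlgebra hAcl, hreg.exists_ne⟩,
    isEssentialAlgebra_gluedAlgebra hLcl hLdense fun n => (hrange n).uniformHolomorphic_ne_top,
    hnat, hnat, hreg⟩
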